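/- Let $\mathcal{E}$ be a locally cartesian closed category (with a terminal object $*$), with a choice of pullback functors $p^*$ and of right adjoints $p_*$ of $p^*$, for all arrows $p$, and let $\mathbb{I}$ be an object of $\mathcal{E}$. *Notation.* Let $\mathcal{E}^{\mathbf 2}_{\mathrm{cart}}$, $\mathcal{E}^{\mathbf 3}_{\mathrm{cart}}$, $\mathcal{E}^{\mathbf 4}_{\mathrm{cart}}$ be the categories of arrows, composable pairs and composable triples of arrows of $\mathcal{E}$, with the natural transformations all of whose squares are pullbacks as morphisms. Let $\mathrm{ev}_{01}$ be the functor that takes the first arrow of a composable pair or triple. By the Beck–Chevalley condition, pushforward defines functors $\Pi\colon \mathcal{E}^{\mathbf 4}_{\mathrm{cart}} \to \mathcal{E}^{\mathbf 3}_{\mathrm{cart}}$, $(r,q,p) \mapsto (p_*r, p_*q)$, and $\Pi\colon \mathcal{E}^{\mathbf 3}_{\mathrm{cart}} \to \mathcal{E}^{\mathbf 2}_{\mathrm{cart}}$, $(q,p)\mapsto p_*q$. Let $\mathcal{E}^{\mathbb R}_{\mathrm{cart}}$ be the category of arrows with a specified section, with the pullback squares that commute with the sections as morphisms. Let $\mathcal{E}^{\mathbf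 2\times\mathbb R}_{\mathrm{cart}}$ be the category of retract diagrams in the arrow category of $\mathcal{E}$, with the natural transformations that are pullback squares at the center arrow and at the retract arrow as morphisms, and let $\mathrm{ev}_c, \mathrm{ev}_r\colon \mathcal{E}^{\mathbf 2\times\mathbb R}_{\mathrm{cart}} \to \mathcal{E}^{\mathbf 2}_{\mathrm{cart}}$ be the evaluations at the center and at the retract. For $p\colon A\to X$, let $\delta\Rightarrow p\colon A^{\mathbb I}\times\mathbb I \to A_\epsilon$ be the map induced by $\epsilon\colon A^{\mathbb I}\times\mathbb I\to A$ and $p^{\mathbb I}\times\mathbb I$ into the pullback $A_\epsilon$ of $p$ along the evaluation $\epsilon\colon X^{\mathbb I}\times\mathbb I\to X$; this defines a functor $\delta\Rightarrow(-)\colon\mathcal{E}^{\mathbf 2}_{\mathrm{cart}}\to\mathcal{E}^{\mathbf 2}_{\mathrm{cart}}$. All fibre products of categories are strict. *Hypotheses.* Let $u\colon \mathbf{TFib}\to\mathcal{E}^{\mathbf 2}$ be a functor such that - (TF0) $u$ is a fibred notion of structure: $\mathrm{cod}\cdot u\colon\mathbf{TFib}\to\mathcal{E}$ is a Grothendieck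 fibration, $u$ is a cartesian functor from $\mathrm{cod}\cdot u$ to $\mathrm{cod}$, and the restriction $u\colon\mathbf{TFib}_{\mathrm{cart}}\to\mathcal{E}^{\mathbf 2}_{\mathrm{cart}}$ to cartesian arrows is a discrete fibration; - (TF1) there is a functor $s\colon \mathbf{TFib}_{\mathrm{cart}}\to\mathcal{E}^{\mathbb R}_{\mathrm{cart}}$ over $\mathcal{E}^{\mathbf 2}_{\mathrm{cart}}$; - (TF2) $\Pi\colon \mathcal{E}^{\mathbf 4}_{\mathrm{cart}} \to \mathcal{E}^{\mathbf 3}_{\mathrm{cart}}$ lifts to a functor from the pullback of $u\colon\mathbf{TFib}_{\mathrm{cart}}\to\mathcal{E}^{\mathbf 2}_{\mathrm{cart}}$ and $\mathrm{ev}_{01}\colon\mathcal{E}^{\mathbf 4}_{\mathrm{cart}}\to\mathcal{E}^{\mathbf 2}_{\mathrm{cart}}$ to the pullback of $u$ and $\mathrm{ev}_{01}\colon\mathcal{E}^{\mathbf 3}_{\mathrm{cart}}\to\mathcal{E}^{\mathbf 2}_{\mathrm{cart}}$; - (TF3) $\mathrm{ev}_r$ lifts to a functor from the pullback of $u\colon\mathbf{TFib}_{\mathrm{cart}}\to\mathcal{E}^{\mathbf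 2}_{\mathrm{cart}}$ and $\mathrm{ev}_c$ to $\mathbf{TFib}_{\mathrm{cart}}$. *Conclusion.* Let $u\colon\mathbf{Fib}_{\mathrm{cart}}\to\mathcal{E}^{\mathbf 2}_{\mathrm{cart}}$ be the pullback of $u\colon\mathbf{TFib}_{\mathrm{cart}}\to\mathcal{E}^{\mathbf 2}_{\mathrm{cart}}$ along $\delta\Rightarrow(-)$, and let $\mathbf{Fib}_{\mathrm{cart}}\times_{\mathcal{E}}\mathbf{Fib}_{\mathrm{cart}}$ be the category of composable pairs $(q,p)$ of objects of $\mathbf{Fib}_{\mathrm{cart}}$, with its functor $u\times u$ to $\mathcal{E}^{\mathbf 3}_{\mathrm{cart}}$. Then $u\colon\mathbf{Fib}_{\mathrm{cart}}\to\mathcal{E}^{\mathbf 2}_{\mathrm{cart}}$ is a discrete fibration; $\mathbf{Fib}_{\mathrm{cart}}$ and $\mathbf{Fib}_{\mathrm{cart}}\times_{\mathcal{E}}\mathbf{Fib}_{\mathrm{cart}}$ are Grothendieck fibrations over $\mathcal{E}$ by means of the codomain (of $p$, for a pair $(q,p)$); and there is a functor $\widetilde\Pi\colon\mathbf{Fib}_{\mathrm{cart}}\times_{\mathcal{E}}\mathbf{Fib}_{\mathrm{cart}}\to\mathbf{Fib}_{\mathrm{cart}}$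 with $u\cdot\widetilde\Pi=\Pi\cdot(u\times u)$ that is a cartesian functor over $\mathcal{E}$. -/

import Mathlib

open CategoryTheory Limits

namespace StructuredFrobenius

universe v u v₁ v₂ v₃ u₁ u₂ u₃

/-! ### Fibrations, cartesian functors, discrete fibrations, strict pullbacks of categories -/

section Fibrations

variable {𝒮 : Type u} [Category.{v} 𝒮]
variable {𝒳 : Type u₁} [Category.{v₁} 𝒳] {𝒴 : Type u₂} [Category.{v₂} 𝒴]

/-- The arrows of `𝒳` that are cartesian with respect to `p : 𝒳 ⥤ 𝒮`. -/
def cartesianArrows (p : 𝒳 ⥤ 𝒮) : MorphismProperty 𝒳 :=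
  fun _ _ φ => p.IsStronglyCartesian (p.map φ) φ

instance (p : 𝒳 ⥤ 𝒮) : (cartesianArrows p).IsMultiplicative where
  id_mem X := by
    have : p.IsStronglyCartesian (𝟙 (p.obj X)) (𝟙 X) := inferInstance
    simpa [cartesianArrows] using this
  comp_mem f g hf hg := by
    have h₁ : p.IsStronglyCartesian (p.map f) f := hf
    have h₂ : p.IsStronglyCartesian (p.map g) g := hg
    have : p.IsStronglyCartesian (p.map f ≫ p.map g) (f ≫ g) := inferInstance
    simpa [cartesianArrows] using this

/-- The wide subcategory of cartesian arrows. -/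
abbrev Cart (p : 𝒳 ⥤ 𝒮) := WideSubcategory (cartesianArrows p)

/-- `F` is a cartesian functor from `p : 𝒳 ⥤ 𝒮` to `q : 𝒴 ⥤ 𝒮`: it is a functor over `𝒮` that
preserves cartesian arrows. -/
structure IsCartesianFunctor (p : 𝒳 ⥤ 𝒮) (q : 𝒴 ⥤ 𝒮) (F : 𝒳 ⥤ 𝒴) : Prop where
  comm : F ⋙ q = p
  map_cartesian : ∀ {X Y : 𝒳} (φ : X ⟶ Y), cartesianArrows p φ → cartesianArrows q (F.map φ)

/-- `F` is a discrete fibration: each arrow `f : b ⟶ F d` has exactly one lift with codomain `d`. -/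
def IsDiscreteFibration (F : 𝒳 ⥤ 𝒴) : Prop :=
  ∀ (d : 𝒳) (b : 𝒴) (f : b ⟶ F.obj d), ∃! e : Σ d' : 𝒳, (d' ⟶ d), F.IsHomLift f e.2

end Fibrations

section StrictPullback

variable {𝒜 : Type u₁} [Category.{v₁} 𝒜] {ℬ : Type u₂} [Category.{v₂} ℬ]
variable {𝒞 : Type u₃} [Category.{v₃} 𝒞]

/-- The objects of the (strict) pullback `𝒜 ×_𝒞 ℬ` of categories. -/
structure StrictPullback (F : 𝒜 ⥤ 𝒞) (G : ℬ ⥤ 𝒞) where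
  fst : 𝒜
  snd : ℬ
  w : F.obj fst = G.obj snd

namespace StrictPullback

variable {F : 𝒜 ⥤ 𝒞} {G : ℬ ⥤ 𝒞}

/-- Arrows of `𝒜 ×_𝒞 ℬ`: pairs of arrows with the same image in `𝒞`. -/
@[ext]
structure Hom (X Y : StrictPullback F G) where
  fst : X.fst ⟶ Y.fst
  snd : X.snd ⟶ Y.snd
  w : F.map fst ≫ eqToHom Y.w = eqToHom X.w ≫ G.map snd

instance : Category (StrictPullback F G) where
  Hom X Y := Hom X Y
  id X := ⟨𝟙 _, 𝟙 _, by simp⟩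
  comp f g := ⟨f.fst ≫ g.fst, f.snd ≫ g.snd, by
    rw [F.map_comp, G.map_comp, Category.assoc, g.w, ← Category.assoc, f.w, Category.assoc]⟩
  id_comp f := by apply Hom.ext <;> simp
  comp_id f := by apply Hom.ext <;> simp
  assoc f g h := by apply Hom.ext <;> simp

variable (F G)

/-- The first projection. -/
def π₁ : StrictPullback F G ⥤ 𝒜 where
  obj X := X.fst
  map f := Hom.fst f

/-- The second projection. -/
def π₂ : StrictPullback F G ⥤ ℬ where
  obj X := X.snd
  map f := Hom.snd f

end StrictPullback

end StrictPullback

/-! ### Diagrams and pullback squares -/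

section Diagrams

variable (C : Type u) [Category.{v} C]

/-- The commutative squares (arrows of the arrow category) that are pullback squares. -/
def pullbackSquares : MorphismProperty (Arrow C) :=
  fun f g φ => IsPullback φ.left f.hom g.hom φ.right

instance : (pullbackSquares C).IsMultiplicative where
  id_mem f := IsPullback.of_horiz_isIso ⟨by simp⟩
  comp_mem _ _ hf hg := IsPullback.paste_horiz hf hg

/-- Arrows of `C` and pullback squares. -/
abbrev CartArrow := WideSubcategory (pullbackSquares C)

variable {C} in
/-- An arrow of `C`, as an object of `CartArrow C`. -/
abbrev CartArrow.of {A X : C} (p : A ⟶ X) : CartArrow C := ⟨Arrow.mk p⟩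

variable {C} in
/-- A pullback square, as an arrow of `CartArrow C`. -/
abbrev CartArrow.homOf {A X A' X' : C} {p' : A' ⟶ X'} {p : A ⟶ X} {a : A' ⟶ A} {x : X' ⟶ X}
    (h : IsPullback a p' p x) : CartArrow.of p' ⟶ CartArrow.of p :=
  ⟨Arrow.homMk a x h.w, h⟩

/-- The codomain functor on arrows and pullback squares. -/
def CartArrow.cod : CartArrow C ⥤ C := wideSubcategoryInclusion _ ⋙ Arrow.rightFunc

/-- Composable pairs `B ⟶ A ⟶ X`, and natural transformations all of whose squares are pullbacks
between them. -/
structure CartPair where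
  {B A X : C}
  q : B ⟶ A
  p : A ⟶ X

namespace CartPair

variable {C}

@[ext]
structure Hom (S T : CartPair C) where
  b : S.B ⟶ T.B
  a : S.A ⟶ T.A
  x : S.X ⟶ T.X
  isPullback_q : IsPullback b S.q T.q a
  isPullback_p : IsPullback a S.p T.p x

instance : Category (CartPair C) where
  Hom S T := Hom S T
  id S := ⟨𝟙 _, 𝟙 _, 𝟙 _, .of_horiz_isIso ⟨by simp⟩, .of_horiz_isIso ⟨by simp⟩⟩
  comp f g := ⟨f.b ≫ g.b, f.a ≫ g.a, f.x ≫ g.x, f.isPullback_q.paste_horiz g.isPullback_q,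
    f.isPullback_p.paste_horiz g.isPullback_p⟩
  id_comp f := by apply Hom.ext <;> simp
  comp_id f := by apply Hom.ext <;> simp
  assoc f g h := by apply Hom.ext <;> simp

variable (C)

/-- `(q, p) ↦ q`. -/
def ev01 : CartPair C ⥤ CartArrow C where
  obj S := .of S.q
  map f := CartArrow.homOf (Hom.isPullback_q f)

/-- `(q, p) ↦ p`. -/
def ev12 : CartPair C ⥤ CartArrow C where
  obj S := .of S.p
  map f := CartArrow.homOf (Hom.isPullback_p f)

/-- `(q : B ⟶ A, p : A ⟶ X) ↦ X`. -/
def cod : CartPair C ⥤ C := ev12 C ⋙ CartArrow.cod C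

end CartPair

/-- Composable triples `D ⟶ B ⟶ A ⟶ X`, and natural transformations all of whose squares are
pullbacks between them. -/
structure CartTriple where
  {D B A X : C}
  r : D ⟶ B
  q : B ⟶ A
  p : A ⟶ X

namespace CartTriple

variable {C}

@[ext]
structure Hom (S T : CartTriple C) where
  d : S.D ⟶ T.D
  b : S.B ⟶ T.B
  a : S.A ⟶ T.A
  x : S.X ⟶ T.X
  isPullback_r : IsPullback d S.r T.r b
  isPullback_q : IsPullback b S.q T.q a
  isPullback_p : IsPullback a S.p T.p x

instance : Category (CartTriple C) where
  Hom S T := Hom S T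
  id S := ⟨𝟙 _, 𝟙 _, 𝟙 _, 𝟙 _, .of_horiz_isIso ⟨by simp⟩, .of_horiz_isIso ⟨by simp⟩,
    .of_horiz_isIso ⟨by simp⟩⟩
  comp f g := ⟨f.d ≫ g.d, f.b ≫ g.b, f.a ≫ g.a, f.x ≫ g.x,
    f.isPullback_r.paste_horiz g.isPullback_r, f.isPullback_q.paste_horiz g.isPullback_q,
    f.isPullback_p.paste_horiz g.isPullback_p⟩
  id_comp f := by apply Hom.ext <;> simp
  comp_id f := by apply Hom.ext <;> simp
  assoc f g h := by apply Hom.ext <;> simp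

variable (C)

/-- `(r, q, p) ↦ r`. -/
def ev01 : CartTriple C ⥤ CartArrow C where
  obj S := .of S.r
  map f := CartArrow.homOf (Hom.isPullback_r f)

variable {C}

/-- `(r, q, p) ↦ (q, p)` on morphisms. -/
def Hom.pair {S T : CartTriple C} (f : S ⟶ T) :
    CartPair.mk S.q S.p ⟶ CartPair.mk T.q T.p :=
  ⟨f.b, f.a, f.x, f.isPullback_q, f.isPullback_p⟩

/-- `(r, q, p) ↦ (r ≫ q, p)` on morphisms. -/
def Hom.compPair {S T : CartTriple C} (f : S ⟶ T) :
    CartPair.mk (S.r ≫ S.q) S.p ⟶ CartPair.mk (T.r ≫ T.q) T.p :=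
  ⟨f.d, f.a, f.x, f.isPullback_r.paste_vert f.isPullback_q, f.isPullback_p⟩

end CartTriple

/-- Diagrams in `C` of the shape of the free retract: an object `retr` with a section
`ret.i : retr ⟶ center` of `ret.r : center ⟶ retr`. -/
structure RetractDiagram where
  {retr center : C}
  ret : Retract retr center

namespace RetractDiagram

variable {C}

/-- Natural transformations of retract diagrams. -/
@[ext]
structure Hom (S T : RetractDiagram C) where
  retr : S.retr ⟶ T.retr
  center : S.center ⟶ T.center
  w_i : S.ret.i ≫ center = retr ≫ T.ret.i
  w_r : S.ret.r ≫ retr = center ≫ T.ret.r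

instance : Category (RetractDiagram C) where
  Hom S T := Hom S T
  id S := ⟨𝟙 _, 𝟙 _, by simp, by simp⟩
  comp f g := ⟨f.retr ≫ g.retr, f.center ≫ g.center,
    by rw [← Category.assoc, f.w_i, Category.assoc, g.w_i, Category.assoc],
    by rw [← Category.assoc, f.w_r, Category.assoc, g.w_r, Category.assoc]⟩
  id_comp f := by apply Hom.ext <;> simp
  comp_id f := by apply Hom.ext <;> simp
  assoc f g h := by apply Hom.ext <;> simp

/-- The natural transformations whose square on the retractions `center ⟶ retr` is a pullback. -/
def cartSections (C : Type u) [Category.{v} C] : MorphismProperty (RetractDiagram C) :=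
  fun S T f => IsPullback (Hom.center f) S.ret.r T.ret.r (Hom.retr f)

instance : (cartSections C).IsMultiplicative where
  id_mem S := IsPullback.of_horiz_isIso (fst := 𝟙 _) (g := 𝟙 _) ⟨by simp⟩
  comp_mem _ _ hf hg := IsPullback.paste_horiz hf hg

/-- For retract diagrams of arrows of `C`: the natural transformations whose components at the
center and at the retract are both pullback squares. -/
def cartRetracts (C : Type u) [Category.{v} C] : MorphismProperty (RetractDiagram (Arrow C)) :=
  fun _ _ f => pullbackSquares C (Hom.center f) ∧ pullbackSquares C (Hom.retr f)

instance : (cartRetracts C).IsMultiplicative where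
  id_mem _ := ⟨(pullbackSquares C).id_mem _, (pullbackSquares C).id_mem _⟩
  comp_mem _ _ hf hg :=
    ⟨(pullbackSquares C).comp_mem _ _ hf.1 hg.1, (pullbackSquares C).comp_mem _ _ hf.2 hg.2⟩

end RetractDiagram

/-- Arrows with a specified section, and pullback squares compatible with the sections. -/
abbrev CartSection := WideSubcategory (RetractDiagram.cartSections C)

/-- Forget the section. -/
def CartSection.arrow : CartSection C ⥤ CartArrow C where
  obj S := .of S.obj.ret.r
  map f := CartArrow.homOf f.property

/-- Retract diagrams of arrows, and natural transformations that are pullback squares at the center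
and at the retract. -/
abbrev CartRetract := WideSubcategory (RetractDiagram.cartRetracts C)

/-- Evaluation at the center arrow. -/
def CartRetract.evCenter : CartRetract C ⥤ CartArrow C where
  obj S := ⟨S.obj.center⟩
  map f := ⟨f.hom.center, f.property.1⟩

/-- Evaluation at the retract arrow. -/
def CartRetract.evRetract : CartRetract C ⥤ CartArrow C where
  obj S := ⟨S.obj.retr⟩
  map f := ⟨f.hom.retr, f.property.2⟩

end Diagrams

/-! ### Pushforward -/

section Pushforward

/-- Chosen right adjoints `p_*` of all pullback functors `p^*`. Together with `HasTerminal C`, this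
says that `C` is locally cartesian closed. -/
abbrev ChosenPushforwards (C : Type u) [Category.{v} C] [ChosenPullbacks C] :=
  ∀ {A X : C} (p : A ⟶ X), ExponentiableMorphism p

variable {C : Type u} [Category.{v} C] [ChosenPullbacks C]

open ChosenPullbacksAlong ExponentiableMorphism

lemma pullback_map_left {A X : C} (p : A ⟶ X) {Y Z : Over X} (f : Y ⟶ Z) :
    ((ChosenPullbacksAlong.pullback p).map f).left =
      lift (f := Z.hom) (g := p) (fst Y.hom p ≫ f.left) (snd Y.hom p)
        (by rw [Category.assoc, Over.w f]; exact condition) := by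
  apply ChosenPullbacksAlong.hom_ext
  · rw [lift_fst _ _ _]
    exact congrArg Over.Hom.left ((mapPullbackAdj p).counit.naturality f)
  · rw [lift_snd _ _ _]
    exact Over.w ((ChosenPullbacksAlong.pullback p).map f)

variable [ChosenPushforwards C]

/-- `p_* q`, as an object over `X`. -/
abbrev push {B A X : C} (q : B ⟶ A) (p : A ⟶ X) : Over X := (pushforward p).obj (Over.mk q)

/-- The evaluation `p^* p_* B ⟶ B`: the counit of `p^* ⊣ p_*`. -/
def pushEv {B A X : C} (q : B ⟶ A) (p : A ⟶ X) : pullbackObj (push q p).hom p ⟶ B :=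
  ((pullbackPushforwardAdj p).counit.app (Over.mk q)).left

lemma pushEv_comp {B A X : C} (q : B ⟶ A) (p : A ⟶ X) :
    pushEv q p ≫ q = snd (push q p).hom p :=
  Over.w ((pullbackPushforwardAdj p).counit.app (Over.mk q))

/-- Evaluating a map `m : W ⟶ p_* B` over `X`: given a pullback `V` of `W` along `p`, the
corresponding map `V ⟶ B` over `A`. -/
def pushEval {B A X : C} (q : B ⟶ A) (p : A ⟶ X) {W V : C} (m : W ⟶ (push q p).left)
    (v₁ : V ⟶ W) (v₂ : V ⟶ A) (h : v₁ ≫ m ≫ (push q p).hom = v₂ ≫ p) : V ⟶ B :=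
  lift (f := (push q p).hom) (g := p) (v₁ ≫ m) v₂ (by simpa using h) ≫ pushEv q p

lemma pushEval_comp_q {B A X : C} (q : B ⟶ A) (p : A ⟶ X) {W V : C} (m : W ⟶ (push q p).left)
    (v₁ : V ⟶ W) (v₂ : V ⟶ A) (h : v₁ ≫ m ≫ (push q p).hom = v₂ ≫ p) :
    pushEval q p m v₁ v₂ h ≫ q = v₂ := by
  rw [pushEval, Category.assoc, pushEv_comp, lift_snd _ _ _]

lemma pushEval_precomp {B A X : C} (q : B ⟶ A) (p : A ⟶ X) {W V V' : C}
    (m : W ⟶ (push q p).left) (v₁ : V ⟶ W) (v₂ : V ⟶ A)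
    (h : v₁ ≫ m ≫ (push q p).hom = v₂ ≫ p) (t : V' ⟶ V) :
    t ≫ pushEval q p m v₁ v₂ h =
      pushEval q p m (t ≫ v₁) (t ≫ v₂) (by rw [Category.assoc, h, Category.assoc]) := by
  rw [pushEval, pushEval, ← Category.assoc]
  congr 1
  apply ChosenPullbacksAlong.hom_ext <;> simp

lemma pushEval_congr {B A X : C} (q : B ⟶ A) (p : A ⟶ X) {W W' V : C}
    (m : W ⟶ (push q p).left) (m' : W' ⟶ (push q p).left) (v₁ : V ⟶ W) (v₁' : V ⟶ W')
    (v₂ v₂' : V ⟶ A)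
    (h : v₁ ≫ m ≫ (push q p).hom = v₂ ≫ p) (h' : v₁' ≫ m' ≫ (push q p).hom = v₂' ≫ p)
    (e : v₁ ≫ m = v₁' ≫ m') (e₂ : v₂ = v₂') :
    pushEval q p m v₁ v₂ h = pushEval q p m' v₁' v₂' h' := by
  subst e₂
  simp only [pushEval, e]

lemma push_exists {B A X : C} (q : B ⟶ A) (p : A ⟶ X) {W V : C} {w : W ⟶ X} {v₁ : V ⟶ W}
    {v₂ : V ⟶ A} (h : IsPullback v₁ v₂ w p) (b : V ⟶ B) (hb : b ≫ q = v₂) :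
    ∃ (m : W ⟶ (push q p).left) (hm : m ≫ (push q p).hom = w),
      pushEval q p m v₁ v₂ (by rw [hm, h.w]) = b := by
  let e : pullbackObj w p ⟶ V := h.lift (fst w p) (snd w p) condition
  let β : (ChosenPullbacksAlong.pullback p).obj (Over.mk w) ⟶ Over.mk q :=
    Over.homMk (e ≫ b) (by
      dsimp only [Over.mk_hom]
      rw [Category.assoc, hb]
      exact h.lift_snd _ _ _)
  let m : Over.mk w ⟶ push q p := pushforwardCurry β
  have hβ : (ChosenPullbacksAlong.pullback p).map m ≫ (pullbackPushforwardAdj p).counit.app (Over.mk q) = β := by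
    have := pushforward_uncurry_curry β
    rwa [pushforwardUncurry, Equiv.invFun_as_coe, Adjunction.homEquiv_counit] at this
  refine ⟨m.left, Over.w m, ?_⟩
  have hβ' : pushEval q p m.left (fst w p) (snd w p)
      (by rw [show m.left ≫ (push q p).hom = w from Over.w m]; exact condition) = e ≫ b := by
    have := congrArg Over.Hom.left hβ
    rw [Over.comp_left, pullback_map_left] at this
    exact this
  have hs : lift (f := w) (g := p) v₁ v₂ h.w ≫ e = 𝟙 V := by
    apply h.hom_ext
    · rw [Category.assoc, h.lift_fst, lift_fst _ _ _, Category.id_comp]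
    · rw [Category.assoc, h.lift_snd, lift_snd _ _ _, Category.id_comp]
  rw [← Category.id_comp b, ← hs, Category.assoc, ← hβ', pushEval_precomp]
  apply pushEval_congr
  · rw [lift_fst _ _ _]
  · rw [lift_snd _ _ _]

lemma push_hom_ext {B A X : C} (q : B ⟶ A) (p : A ⟶ X) {W V : C} {v₁ : V ⟶ W}
    {v₂ : V ⟶ A} {m m' : W ⟶ (push q p).left}
    (h : IsPullback v₁ v₂ (m ≫ (push q p).hom) p)
    (hm : m' ≫ (push q p).hom = m ≫ (push q p).hom)
    (e : pushEval q p m v₁ v₂ h.w = pushEval q p m' v₁ v₂ (by rw [hm, h.w])) : m = m' := by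
  let M : Over.mk (m ≫ (push q p).hom) ⟶ push q p := Over.homMk m
  let M' : Over.mk (m ≫ (push q p).hom) ⟶ push q p := Over.homMk m' hm
  suffices M = M' from congrArg Over.Hom.left this
  apply ((pullbackPushforwardAdj p).homEquiv _ _).symm.injective
  rw [Adjunction.homEquiv_counit, Adjunction.homEquiv_counit]
  apply Over.OverMorphism.ext
  rw [Over.comp_left, Over.comp_left, pullback_map_left, pullback_map_left]
  let t := h.lift (fst (m ≫ (push q p).hom) p) (snd (m ≫ (push q p).hom) p) condition
  have := congrArg (t ≫ ·) e
  simp only [pushEval_precomp, t, IsPullback.lift_fst, IsPullback.lift_snd] at this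
  exact this

/-- For a morphism of composable pairs `(q', p') ⟶ (q, p)`, the map `p'_* B' ⟶ p_* B` over
`X' ⟶ X` exists and is unique. -/
lemma exists_pushMap {S T : CartPair C} (f : S ⟶ T) :
    ∃ (m : (push S.q S.p).left ⟶ (push T.q T.p).left)
      (hm : m ≫ (push T.q T.p).hom = (push S.q S.p).hom ≫ f.x),
      pushEval T.q T.p m (fst (push S.q S.p).hom S.p) (snd (push S.q S.p).hom S.p ≫ f.a)
        (by rw [hm, ← Category.assoc, condition, Category.assoc, Category.assoc,
          f.isPullback_p.w]) = pushEv S.q S.p ≫ f.b :=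
  push_exists T.q T.p ((isPullback (push S.q S.p).hom S.p).flip.paste_horiz f.isPullback_p).flip _
    (by rw [Category.assoc, f.isPullback_q.w, ← Category.assoc, pushEv_comp])

/-- The action of pushforward on a morphism of composable pairs: the map `p'_* B' ⟶ p_* B` over
`X' ⟶ X` whose transpose is `p'^* p'_* B' ⟶ B' ⟶ B`. -/
noncomputable def pushMap {S T : CartPair C} (f : S ⟶ T) :
    (push S.q S.p).left ⟶ (push T.q T.p).left := (exists_pushMap f).choose

lemma pushMap_hom {S T : CartPair C} (f : S ⟶ T) :
    pushMap f ≫ (push T.q T.p).hom = (push S.q S.p).hom ≫ f.x :=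
  (exists_pushMap f).choose_spec.choose

lemma pushMap_w {S T : CartPair C} (f : S ⟶ T) {V : C} {v₁ : V ⟶ (push S.q S.p).left}
    {v₂ : V ⟶ S.A} (h : v₁ ≫ (push S.q S.p).hom = v₂ ≫ S.p) :
    v₁ ≫ pushMap f ≫ (push T.q T.p).hom = (v₂ ≫ f.a) ≫ T.p := by
  rw [pushMap_hom, ← Category.assoc, h, Category.assoc, Category.assoc, f.isPullback_p.w]

lemma pushEval_pushMap {S T : CartPair C} (f : S ⟶ T) {V W : C} (m : W ⟶ (push S.q S.p).left)
    (v₁ : V ⟶ W) (v₂ : V ⟶ S.A) (h : v₁ ≫ m ≫ (push S.q S.p).hom = v₂ ≫ S.p) :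
    pushEval T.q T.p (m ≫ pushMap f) v₁ (v₂ ≫ f.a)
      (by simpa using pushMap_w f (v₁ := v₁ ≫ m) (by simpa using h)) =
      pushEval S.q S.p m v₁ v₂ h ≫ f.b := by
  have key := (exists_pushMap f).choose_spec.choose_spec
  generalize_proofs w
  rw [pushEval.eq_def S.q, Category.assoc, ← key, pushEval_precomp]
  apply pushEval_congr
  · rw [lift_fst _ _ _, Category.assoc]; rfl
  · rw [← Category.assoc, lift_snd _ _ _]

lemma pushMap_unique {S T : CartPair C} (f : S ⟶ T)
    (m : (push S.q S.p).left ⟶ (push T.q T.p).left)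
    (hm : m ≫ (push T.q T.p).hom = (push S.q S.p).hom ≫ f.x)
    (e : pushEval T.q T.p m (fst (push S.q S.p).hom S.p) (snd (push S.q S.p).hom S.p ≫ f.a)
        (by rw [hm, ← Category.assoc, condition, Category.assoc, Category.assoc,
          f.isPullback_p.w]) = pushEv S.q S.p ≫ f.b) : m = pushMap f := by
  apply push_hom_ext T.q T.p (v₁ := fst (push S.q S.p).hom S.p)
    (v₂ := snd (push S.q S.p).hom S.p ≫ f.a)
  · rw [e]; exact (exists_pushMap f).choose_spec.choose_spec.symm
  · rw [hm]
    exact ((isPullback (push S.q S.p).hom S.p).flip.paste_horiz f.isPullback_p).flip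
  · rw [hm, pushMap_hom]

lemma pushEval_id {B A X : C} (q : B ⟶ A) (p : A ⟶ X) :
    pushEval q p (𝟙 _) (fst (push q p).hom p) (snd (push q p).hom p)
      (by rw [Category.id_comp]; exact condition) = pushEv q p := by
  rw [pushEval]
  conv_rhs => rw [← Category.id_comp (pushEv q p)]
  congr 1
  apply ChosenPullbacksAlong.hom_ext
  · rw [lift_fst _ _ _, Category.id_comp, Category.comp_id]
  · rw [lift_snd _ _ _, Category.id_comp]

lemma pushMap_id (S : CartPair C) : pushMap (𝟙 S) = 𝟙 _ := by
  symm
  apply pushMap_unique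
  · refine Eq.trans ?_ ((pushEval_id S.q S.p).trans (Category.comp_id _).symm)
    exact pushEval_congr _ _ _ _ _ _ _ _ _ _ rfl (Category.comp_id _)
  · exact (Category.id_comp _).trans (Category.comp_id _).symm

lemma pushMap_comp {S T U : CartPair C} (f : S ⟶ T) (g : T ⟶ U) :
    pushMap (f ≫ g) = pushMap f ≫ pushMap g := by
  symm
  have h₁ : fst (push S.q S.p).hom S.p ≫ 𝟙 _ ≫ (push S.q S.p).hom =
      snd (push S.q S.p).hom S.p ≫ S.p := by rw [Category.id_comp]; exact condition
  have e₁ := pushEval_pushMap f (𝟙 _) _ _ h₁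
  have e₂ := pushEval_pushMap g (𝟙 _ ≫ pushMap f) _ (snd (push S.q S.p).hom S.p ≫ f.a)
    (by rw [Category.id_comp]; exact pushMap_w f condition)
  apply pushMap_unique
  · rw [e₁, pushEval_id] at e₂
    refine Eq.trans ?_ (e₂.trans (Category.assoc _ _ _))
    apply pushEval_congr
    · rw [Category.id_comp]
    · exact (Category.assoc _ _ _).symm
  · rw [Category.assoc, pushMap_hom, ← Category.assoc, pushMap_hom, Category.assoc]; rfl

/-- The Beck–Chevalley condition: pushforward takes pullback squares to pullback squares. -/
lemma isPullback_pushMap {S T : CartPair C} (f : S ⟶ T) :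
    IsPullback (pushMap f) (push S.q S.p).hom (push T.q T.p).hom f.x := by
  have exu : ∀ {Y : C} (a : Y ⟶ (push T.q T.p).left) (b : Y ⟶ S.X)
      (_ : a ≫ (push T.q T.p).hom = b ≫ f.x),
      ∃! m : Y ⟶ (push S.q S.p).left, m ≫ pushMap f = a ∧ m ≫ (push S.q S.p).hom = b := by
    intro Y a b hab
    have hV := isPullback b S.p
    have hV' := (hV.flip.paste_horiz f.isPullback_p).flip
    have ha : fst b S.p ≫ a ≫ (push T.q T.p).hom = (snd b S.p ≫ f.a) ≫ T.p := by
      rw [hab, hV'.w]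
    let b₀ := pushEval T.q T.p a (fst b S.p) (snd b S.p ≫ f.a) ha
    let b' := f.isPullback_q.lift b₀ (snd b S.p) (pushEval_comp_q _ _ _ _ _ _)
    obtain ⟨m, hm, hev⟩ := push_exists S.q S.p hV b' (f.isPullback_q.lift_snd _ _ _)
    refine ⟨m, ⟨?_, hm⟩, ?_⟩
    · symm
      apply push_hom_ext T.q T.p (v₁ := fst b S.p) (v₂ := snd b S.p ≫ f.a)
      · rw [pushEval_pushMap f m (fst b S.p) (snd b S.p) (by rw [hm, hV.w]), hev]
        exact (f.isPullback_q.lift_fst _ _ _).symm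
      · rw [hab]; exact hV'
      · rw [Category.assoc, pushMap_hom, ← Category.assoc, hm, hab]
    · rintro m' ⟨h₁, h₂⟩
      have w' : fst b S.p ≫ m' ≫ (push S.q S.p).hom = snd b S.p ≫ S.p := by rw [h₂, hV.w]
      have hV'' : IsPullback (fst b S.p) (snd b S.p) (m' ≫ (push S.q S.p).hom) S.p := by
        rw [h₂]; exact hV
      refine push_hom_ext S.q S.p hV'' (by rw [hm, h₂]) (Eq.trans ?_ hev.symm)
      apply f.isPullback_q.hom_ext
      · rw [← pushEval_pushMap f m' _ _ w', f.isPullback_q.lift_fst]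
        exact pushEval_congr _ _ _ _ _ _ _ _ _ _ (by rw [h₁]) rfl
      · rw [pushEval_comp_q, f.isPullback_q.lift_snd]
  refine ⟨⟨pushMap_hom f⟩, ⟨PullbackCone.IsLimit.mk _
    (fun s => (exu s.fst s.snd s.condition).choose)
    (fun s => (exu s.fst s.snd s.condition).choose_spec.1.1)
    (fun s => (exu s.fst s.snd s.condition).choose_spec.1.2)
    (fun s m h₁ h₂ => (exu s.fst s.snd s.condition).choose_spec.2 m ⟨h₁, h₂⟩)⟩⟩

/-- The pushforward functor on composable pairs, `(q, p) ↦ p_* q`. -/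
noncomputable def pushPair : CartPair C ⥤ CartArrow C where
  obj S := .of (push S.q S.p).hom
  map f := CartArrow.homOf (isPullback_pushMap f)
  map_id S := by
    apply WideSubcategory.hom_ext
    exact Arrow.hom_ext _ _ (pushMap_id S) rfl
  map_comp f g := by
    apply WideSubcategory.hom_ext
    exact Arrow.hom_ext _ _ (pushMap_comp f g) rfl

/-- `p_* r : p_* (r ≫ q) ⟶ p_* q`, for an arrow `r : D ⟶ B` over `A`. -/
def pushArrow {D B A X : C} (r : D ⟶ B) (q : B ⟶ A) (p : A ⟶ X) :
    (push (r ≫ q) p).left ⟶ (push q p).left :=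
  ((pushforward p).map (Over.homMk r : Over.mk (r ≫ q) ⟶ Over.mk q)).left

lemma pushArrow_hom {D B A X : C} (r : D ⟶ B) (q : B ⟶ A) (p : A ⟶ X) :
    pushArrow r q p ≫ (push q p).hom = (push (r ≫ q) p).hom :=
  Over.w ((pushforward p).map (Over.homMk r : Over.mk (r ≫ q) ⟶ Over.mk q))

lemma pushEval_pushArrow {D B A X : C} (r : D ⟶ B) (q : B ⟶ A) (p : A ⟶ X) {W V : C}
    (m : W ⟶ (push (r ≫ q) p).left) (v₁ : V ⟶ W) (v₂ : V ⟶ A)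
    (h : v₁ ≫ m ≫ (push (r ≫ q) p).hom = v₂ ≫ p) :
    pushEval q p (m ≫ pushArrow r q p) v₁ v₂
      (by rw [Category.assoc, pushArrow_hom, h]) = pushEval (r ≫ q) p m v₁ v₂ h ≫ r := by
  let R : Over.mk (r ≫ q) ⟶ Over.mk q := Over.homMk r
  have nat := congrArg Over.Hom.left ((pullbackPushforwardAdj p).counit.naturality R)
  have nat' : lift (f := (push q p).hom) (g := p)
      (fst (push (r ≫ q) p).hom p ≫ pushArrow r q p) (snd (push (r ≫ q) p).hom p)
      (by rw [Category.assoc, pushArrow_hom]; exact condition) ≫ pushEv q p =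
      pushEv (r ≫ q) p ≫ r := by
    refine Eq.trans ?_ nat
    exact congrArg (· ≫ pushEv q p) (pullback_map_left p ((pushforward p).map R)).symm
  generalize_proofs w
  rw [pushEval.eq_def (r ≫ q), Category.assoc, ← nat', ← Category.assoc, pushEval]
  congr 1
  apply ChosenPullbacksAlong.hom_ext
  · rw [Category.assoc, lift_fst _ _ _, lift_fst _ _ _, ← Category.assoc, ← Category.assoc,
      lift_fst _ _ _]
  · rw [Category.assoc, lift_snd _ _ _, lift_snd _ _ _, lift_snd _ _ _]

lemma pushArrow_naturality {D B A X D' B' A' X' : C} {r : D ⟶ B} {q : B ⟶ A} {p : A ⟶ X}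
    {r' : D' ⟶ B'} {q' : B' ⟶ A'} {p' : A' ⟶ X'}
    (f : CartPair.mk (r' ≫ q') p' ⟶ CartPair.mk (r ≫ q) p)
    (g : CartPair.mk q' p' ⟶ CartPair.mk q p)
    (hb : f.b ≫ r = r' ≫ g.b) (ha : f.a = g.a) (hx : f.x = g.x) :
    pushMap f ≫ pushArrow r q p = pushArrow r' q' p' ≫ pushMap g := by
  let P := push (r' ≫ q') p'
  have w : fst P.hom p' ≫ 𝟙 _ ≫ P.hom = snd P.hom p' ≫ p' := by
    rw [Category.id_comp]; exact condition
  have h₁ := pushEval_pushMap f (𝟙 _) _ _ w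
  have h₂ := pushEval_pushArrow r q p (𝟙 _ ≫ pushMap f)
    (fst P.hom p') (snd P.hom p' ≫ f.a)
    (by rw [Category.id_comp]; exact pushMap_w f condition)
  have h₃ := pushEval_pushArrow r' q' p' (𝟙 _) _ _ w
  have h₄ := pushEval_pushMap g (𝟙 _ ≫ pushArrow r' q' p')
    (fst P.hom p') (snd P.hom p') (by rw [Category.assoc, pushArrow_hom]; exact w)
  have e₁ : (pushMap f ≫ pushArrow r q p) ≫ (push q p).hom = P.hom ≫ f.x := by
    rw [Category.assoc, pushArrow_hom, pushMap_hom]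
  have e₂ : (pushArrow r' q' p' ≫ pushMap g) ≫ (push q p).hom = P.hom ≫ f.x := by
    rw [Category.assoc, pushMap_hom, ← Category.assoc, pushArrow_hom, hx]
  apply push_hom_ext q p (v₁ := fst P.hom p') (v₂ := snd P.hom p' ≫ f.a)
  · have h₅ := h₂.trans (congrArg (· ≫ r) h₁)
    have h₆ := h₄.trans (congrArg (· ≫ g.b) h₃)
    simp only [Category.assoc, hb] at h₅ h₆
    refine Eq.trans ?_ ((h₅.trans h₆.symm).trans ?_)
    · exact pushEval_congr _ _ _ _ _ _ _ _ _ _ (by simp) rfl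
    · exact pushEval_congr _ _ _ _ _ _ _ _ _ _ (by simp) (by rw [ha])
  · rw [e₁]; exact ((isPullback P.hom p').flip.paste_horiz f.isPullback_p).flip
  · rw [e₁, e₂]

/-- The pushforward functor on composable triples, `(r, q, p) ↦ (p_* r, p_* q)`. -/
noncomputable def pushTriple : CartTriple C ⥤ CartPair C where
  obj S := ⟨pushArrow S.r S.q S.p, (push S.q S.p).hom⟩
  map {S T} f :=
    { b := pushMap (CartTriple.Hom.compPair f)
      a := pushMap (CartTriple.Hom.pair f)
      x := f.x
      isPullback_q := by
        refine IsPullback.of_bot ?_ (pushArrow_naturality (CartTriple.Hom.compPair f)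
          (CartTriple.Hom.pair f) f.isPullback_r.w rfl rfl)
          (isPullback_pushMap (CartTriple.Hom.pair f))
        have := isPullback_pushMap (CartTriple.Hom.compPair f)
        rw [← pushArrow_hom, ← pushArrow_hom] at this
        exact this
      isPullback_p := isPullback_pushMap (CartTriple.Hom.pair f) }
  map_id S := by
    apply CartPair.Hom.ext
    · exact pushMap_id (CartPair.mk (S.r ≫ S.q) S.p)
    · exact pushMap_id (CartPair.mk S.q S.p)
    · rfl
  map_comp f g := by
    apply CartPair.Hom.ext
    · exact pushMap_comp (CartTriple.Hom.compPair f) (CartTriple.Hom.compPair g)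
    · exact pushMap_comp (CartTriple.Hom.pair f) (CartTriple.Hom.pair g)
    · rfl

end Pushforward

/-! ### The interval and the functor `δ ⇒ (-)` -/

section Interval

open ChosenPullbacksAlong ExponentiableMorphism

variable {C : Type u} [Category.{v} C] [HasTerminal C] [ChosenPullbacks C]

/-- The identification of `C` with the slice over the terminal object. -/
noncomputable abbrev toSlice : C ⥤ Over (⊤_ C) :=
  (Over.equivalenceOfIsTerminal (terminalIsTerminal (C := C))).inverse

variable (I : C)

/-- `!^* : C ⥤ C / I`, the pullback along `! : I ⟶ ⊤_ C`. -/
noncomputable abbrev bangPullback : C ⥤ Over I :=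
  toSlice ⋙ ChosenPullbacksAlong.pullback (terminal.from I)

/-- `(-) × I`, the composite `!_! !^*`. -/
noncomputable def timesI : C ⥤ C := bangPullback I ⋙ Over.forget I

/-- The projection `X × I ⟶ X`: the counit of `!_! ⊣ !^*`. -/
noncomputable def timesIFst : timesI I ⟶ 𝟭 C where
  app X := ((mapPullbackAdj (terminal.from I)).counit.app (toSlice.obj X)).left
  naturality _ _ f :=
    congrArg Over.Hom.left ((mapPullbackAdj (terminal.from I)).counit.naturality (toSlice.map f))

lemma bangPullback_preserves : PreservesLimitsOfShape WalkingCospan (bangPullback I) := by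
  have : PreservesLimitsOfShape WalkingCospan
      (ChosenPullbacksAlong.pullback (terminal.from I)) :=
    (mapPullbackAdj (terminal.from I)).rightAdjoint_preservesLimits.preservesLimitsOfShape
  infer_instance

instance timesI_preserves : PreservesLimitsOfShape WalkingCospan (timesI I) := by
  have := bangPullback_preserves I
  have : PreservesLimitsOfShape WalkingCospan (Over.forget I) := inferInstance
  unfold timesI
  infer_instance

variable [ChosenPushforwards C]

/-- `(-)^I`, the composite `!_* !^*`. -/
noncomputable def pathObj : C ⥤ C :=
  bangPullback I ⋙ pushforward (terminal.from I) ⋙ Over.forget (⊤_ C)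

/-- `(-)^I × I`. -/
noncomputable abbrev pathTimes : C ⥤ C := pathObj I ⋙ timesI I

/-- The identification of `X^I`, as an object of `C / ⊤_ C`, with `!_* !^* X`. -/
noncomputable def toSlicePathObj (X : C) : toSlice.obj ((pathObj I).obj X) ⟶
    (pushforward (terminal.from I)).obj ((bangPullback I).obj X) :=
  Over.homMk (𝟙 _) (terminal.hom_ext _ _)

lemma toSlicePathObj_naturality {X Y : C} (f : X ⟶ Y) :
    toSlice.map ((pathObj I).map f) ≫ toSlicePathObj I Y =
      toSlicePathObj I X ≫ (pushforward (terminal.from I)).map ((bangPullback I).map f) := by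
  apply Over.OverMorphism.ext
  exact (Category.comp_id _).trans (Category.id_comp _).symm

/-- The counit of `!^* ⊣ !_*`, as a map `X^I × I ⟶ X × I` over `I`. -/
noncomputable def evalOver (X : C) :
    (bangPullback I).obj ((pathObj I).obj X) ⟶ (bangPullback I).obj X :=
  (ChosenPullbacksAlong.pullback (terminal.from I)).map (toSlicePathObj I X) ≫
    (pullbackPushforwardAdj (terminal.from I)).counit.app ((bangPullback I).obj X)

lemma evalOver_naturality {X Y : C} (f : X ⟶ Y) :
    (bangPullback I).map ((pathObj I).map f) ≫ evalOver I Y =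
      evalOver I X ≫ (bangPullback I).map f := by
  have h₁ := congrArg (ChosenPullbacksAlong.pullback (terminal.from I)).map
    (toSlicePathObj_naturality I f)
  rw [Functor.map_comp, Functor.map_comp] at h₁
  have h₂ := (pullbackPushforwardAdj (terminal.from I)).counit.naturality ((bangPullback I).map f)
  unfold evalOver
  rw [Category.assoc]
  refine Eq.trans ?_ (congrArg
    ((ChosenPullbacksAlong.pullback (terminal.from I)).map (toSlicePathObj I X) ≫ ·) h₂)
  refine (Category.assoc _ _ _).symm.trans ?_
  refine (congrArg (· ≫ (pullbackPushforwardAdj (terminal.from I)).counit.app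
    ((bangPullback I).obj Y)) h₁).trans (Category.assoc _ _ _)

/-- The evaluation `ε : X^I × I ⟶ X`: the counit of `!^* ⊣ !_*`, followed by the counit of
`!_! ⊣ !^*`. -/
noncomputable def evalI : pathTimes I ⟶ 𝟭 C where
  app X := (Over.forget I).map (evalOver I X) ≫ (timesIFst I).app X
  naturality X Y f := by
    have h₁ := congrArg (Over.forget I).map (evalOver_naturality I f)
    rw [Functor.map_comp, Functor.map_comp] at h₁
    have h₂ := (timesIFst I).naturality f
    refine (Category.assoc _ _ _).symm.trans ?_
    refine (congrArg (· ≫ (timesIFst I).app Y) h₁).trans ?_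
    refine (Category.assoc _ _ _).trans ?_
    refine (congrArg ((Over.forget I).map (evalOver I X) ≫ ·) h₂).trans ?_
    exact (Category.assoc _ _ _).symm

/-- The map `δ ⇒ p : A^I × I ⟶ A_ε` into the pullback `A_ε` of `p` along `ε`. -/
noncomputable def leibniz {A X : C} (p : A ⟶ X) :
    (pathTimes I).obj A ⟶ pullbackObj p ((evalI I).app X) :=
  lift ((evalI I).app A) ((pathTimes I).map p) ((evalI I).naturality p).symm

instance pathObj_preserves : PreservesLimitsOfShape WalkingCospan (pathObj I) := by
  have := bangPullback_preserves I
  have : PreservesLimitsOfShape WalkingCospan (pushforward (terminal.from I)) :=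
    (pullbackPushforwardAdj (terminal.from I)).rightAdjoint_preservesLimits.preservesLimitsOfShape
  have : PreservesLimitsOfShape WalkingCospan (Over.forget (⊤_ C)) := inferInstance
  unfold pathObj
  infer_instance

/-- The map `A'_ε ⟶ A_ε` induced by a commutative square. -/
noncomputable def leibnizBase {A X A' X' : C} {p' : A' ⟶ X'} {p : A ⟶ X} {a : A' ⟶ A} {x : X' ⟶ X}
    (h : a ≫ p = p' ≫ x) :
    pullbackObj p' ((evalI I).app X') ⟶ pullbackObj p ((evalI I).app X) :=
  pullbackMap _ _ _ _ a ((pathTimes I).map x) x h.symm ((evalI I).naturality x).symm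

lemma leibnizBase_fst {A X A' X' : C} {p' : A' ⟶ X'} {p : A ⟶ X} {a : A' ⟶ A} {x : X' ⟶ X}
    (h : a ≫ p = p' ≫ x) :
    leibnizBase I h ≫ fst p ((evalI I).app X) = fst p' ((evalI I).app X') ≫ a :=
  pullbackMap_fst h.symm ((evalI I).naturality x).symm

lemma leibnizBase_snd {A X A' X' : C} {p' : A' ⟶ X'} {p : A ⟶ X} {a : A' ⟶ A} {x : X' ⟶ X}
    (h : a ≫ p = p' ≫ x) :
    leibnizBase I h ≫ snd p ((evalI I).app X) =
      snd p' ((evalI I).app X') ≫ (pathTimes I).map x :=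
  pullbackMap_snd h.symm ((evalI I).naturality x).symm

lemma leibnizBase_id {A X : C} (p : A ⟶ X) (h : 𝟙 A ≫ p = p ≫ 𝟙 X) :
    leibnizBase I h = 𝟙 _ := by
  apply ChosenPullbacksAlong.hom_ext
  · rw [leibnizBase_fst, Category.comp_id, Category.id_comp]
  · rw [leibnizBase_snd, CategoryTheory.Functor.map_id, Category.comp_id, Category.id_comp]

lemma leibnizBase_comp {A X A' X' A'' X'' : C} {p'' : A'' ⟶ X''} {p' : A' ⟶ X'} {p : A ⟶ X}
    {a' : A'' ⟶ A'} {x' : X'' ⟶ X'} {a : A' ⟶ A} {x : X' ⟶ X}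
    (h' : a' ≫ p' = p'' ≫ x') (h : a ≫ p = p' ≫ x) (h'' : (a' ≫ a) ≫ p = p'' ≫ x' ≫ x) :
    leibnizBase I h'' = leibnizBase I h' ≫ leibnizBase I h := by
  apply ChosenPullbacksAlong.hom_ext
  · rw [leibnizBase_fst, Category.assoc, leibnizBase_fst, ← Category.assoc, ← Category.assoc,
      leibnizBase_fst]
  · rw [leibnizBase_snd, Category.assoc, leibnizBase_snd, Functor.map_comp, ← Category.assoc,
      ← Category.assoc, leibnizBase_snd]

lemma isPullback_leibnizBase {A X A' X' : C} {p' : A' ⟶ X'} {p : A ⟶ X} {a : A' ⟶ A}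
    {x : X' ⟶ X} (h : IsPullback a p' p x) :
    IsPullback (leibnizBase I h.w) (snd p' ((evalI I).app X')) (snd p ((evalI I).app X))
      ((pathTimes I).map x) := by
  refine IsPullback.of_right (h₁₂ := fst p ((evalI I).app X)) (h₂₂ := (evalI I).app X) (v₁₃ := p)
    ?_ (leibnizBase_snd I h.w) (isPullback p ((evalI I).app X))
  rw [leibnizBase_fst]
  have e : (pathTimes I).map x ≫ (evalI I).app X = (evalI I).app X' ≫ x := (evalI I).naturality x
  rw [e]
  exact (isPullback p' ((evalI I).app X')).paste_horiz h

/-- `δ ⇒ (-)` takes pullback squares to pullback squares. -/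
lemma isPullback_leibniz {A X A' X' : C} {p' : A' ⟶ X'} {p : A ⟶ X} {a : A' ⟶ A}
    {x : X' ⟶ X} (h : IsPullback a p' p x) :
    IsPullback ((pathTimes I).map a) (leibniz I p') (leibniz I p) (leibnizBase I h.w) := by
  refine IsPullback.of_bot (v₂₁ := snd p' ((evalI I).app X')) (v₂₂ := snd p ((evalI I).app X))
    (h₃₁ := (pathTimes I).map x) ?_ ?_ (isPullback_leibnizBase I h)
  · rw [leibniz, leibniz, lift_snd _ _ _, lift_snd _ _ _]
    exact h.map (pathTimes I)
  · apply ChosenPullbacksAlong.hom_ext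
    · rw [Category.assoc, Category.assoc,
        leibnizBase_fst, leibniz, leibniz, lift_fst _ _ _, ← Category.assoc, lift_fst _ _ _]
      exact (evalI I).naturality a
    · rw [Category.assoc, Category.assoc,
        leibnizBase_snd, leibniz, leibniz, lift_snd _ _ _, ← Category.assoc, lift_snd _ _ _,
        ← Functor.map_comp, ← Functor.map_comp, h.w]

/-- The functor `δ ⇒ (-)` on arrows and pullback squares. -/
noncomputable def leibnizFunctor : CartArrow C ⥤ CartArrow C where
  obj p := .of (leibniz I p.obj.hom)
  map f := CartArrow.homOf (isPullback_leibniz I f.property)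
  map_id p := by
    apply WideSubcategory.hom_ext
    exact Arrow.hom_ext _ _ ((pathTimes I).map_id _) (leibnizBase_id I p.obj.hom (by simp))
  map_comp f g := by
    apply WideSubcategory.hom_ext
    exact Arrow.hom_ext _ _ ((pathTimes I).map_comp _ _)
      (leibnizBase_comp I f.property.w g.property.w (f ≫ g).property.w)

end Interval

/-! ### Structured trivial fibrations and structured fibrations -/

section Structured

variable {C : Type u} [Category.{v} C] {TFib : Type u₁} [Category.{v₁} TFib]

/-- A commutative square that is cartesian for the codomain functor is a pullback square. -/
lemma pullbackSquares_of_cartesian {f g : Arrow C} (φ : f ⟶ g)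
    (h : cartesianArrows (Arrow.rightFunc : Arrow C ⥤ C) φ) : pullbackSquares C φ := by
  have hφ : (Arrow.rightFunc : Arrow C ⥤ C).IsStronglyCartesian (Arrow.rightFunc.map φ) φ := h
  have exu : ∀ {Y : C} (a : Y ⟶ g.left) (b : Y ⟶ f.right) (_ : a ≫ g.hom = b ≫ φ.right),
      ∃! m : Y ⟶ f.left, m ≫ φ.left = a ∧ m ≫ f.hom = b := by
    intro Y a b hab
    let ψ : Arrow.mk b ⟶ g := Arrow.homMk a φ.right hab
    have hψ : (Arrow.rightFunc : Arrow C ⥤ C).IsHomLift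
        (𝟙 f.right ≫ (Arrow.rightFunc : Arrow C ⥤ C).map φ) ψ := by
      rw [show 𝟙 f.right ≫ (Arrow.rightFunc : Arrow C ⥤ C).map φ =
        (Arrow.rightFunc : Arrow C ⥤ C).map ψ from Category.id_comp _]
      exact Functor.IsHomLift.map ψ
    obtain ⟨χ, ⟨h₁, h₂⟩, h₃⟩ :=
      @hφ.universal_property' (Arrow.mk b) (𝟙 f.right) ψ hψ
    have hχ : 𝟙 f.right = χ.right :=
      IsHomLift.eq_of_isHomLift (a := Arrow.mk b) (b := f)
        (Arrow.rightFunc : Arrow C ⥤ C) (𝟙 f.right) χ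
    refine ⟨χ.left, ⟨congrArg Arrow.Hom.left h₂, ?_⟩, ?_⟩
    · have := Arrow.w χ
      rw [← hχ] at this
      exact this.trans (Category.comp_id _)
    · rintro m ⟨e₁, e₂⟩
      let χ' : Arrow.mk b ⟶ f := Arrow.homMk m (𝟙 f.right) (e₂.trans (Category.comp_id _).symm)
      have hχ' : χ' = χ := by
        refine h₃ χ' ⟨?_, Arrow.hom_ext _ _ e₁ (Category.id_comp _)⟩
        exact (inferInstance : (Arrow.rightFunc : Arrow C ⥤ C).IsHomLift
          ((Arrow.rightFunc : Arrow C ⥤ C).map χ') χ')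
      exact congrArg Arrow.Hom.left hχ'
  exact ⟨⟨Arrow.w φ⟩, ⟨PullbackCone.IsLimit.mk _
    (fun s => (exu s.fst s.snd s.condition).choose)
    (fun s => (exu s.fst s.snd s.condition).choose_spec.1.1)
    (fun s => (exu s.fst s.snd s.condition).choose_spec.1.2)
    (fun s m h₁ h₂ => (exu s.fst s.snd s.condition).choose_spec.2 m ⟨h₁, h₂⟩)⟩⟩

section Restriction

variable {u : TFib ⥤ Arrow C} (hu : IsCartesianFunctor (u ⋙ Arrow.rightFunc) Arrow.rightFunc u)

/-- The restriction of a cartesian functor `u : TFib ⥤ Arrow C` to the wide subcategories of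
cartesian arrows. -/
def restrictCart : Cart (u ⋙ Arrow.rightFunc) ⥤ CartArrow C where
  obj t := ⟨u.obj t.obj⟩
  map f := ⟨u.map f.hom, pullbackSquares_of_cartesian _ (hu.map_cartesian f.hom f.property)⟩
  map_id _ := WideSubcategory.hom_ext _ (u.map_id _)
  map_comp _ _ := WideSubcategory.hom_ext _ (u.map_comp _ _)

end Restriction

/-- `u : TFib ⥤ Arrow C` is a fibred notion of structure: `cod ∘ u` is a Grothendieck fibration, `u`
is a cartesian functor, and `u` restricts to a discrete fibration on cartesian arrows. -/
structure IsFibredNotionOfStructure (u : TFib ⥤ Arrow C) : Prop where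
  isFibered : (u ⋙ Arrow.rightFunc).IsFibered
  isCartesianFunctor : IsCartesianFunctor (u ⋙ Arrow.rightFunc) Arrow.rightFunc u
  isDiscreteFibration : IsDiscreteFibration (restrictCart isCartesianFunctor)

variable {u : TFib ⥤ Arrow C} (hu : IsFibredNotionOfStructure u)

/-- The discrete fibration `u : TFib_cart ⥤ E^2_cart` of structured trivial fibrations. -/
abbrev uCart : Cart (u ⋙ Arrow.rightFunc) ⥤ CartArrow C := restrictCart hu.isCartesianFunctor

/-- Structured trivial fibrations have chosen sections that are stable under pullback. -/
def HasStableSections : Prop :=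
  ∃ s : Cart (u ⋙ Arrow.rightFunc) ⥤ CartSection C, s ⋙ CartSection.arrow C = uCart hu

/-- The lift of evaluation at the retract to the category of retract diagrams of arrows whose center
is a structured trivial fibration. -/
def HasRetractLift : Prop :=
  ∃ L : StrictPullback (CartRetract.evCenter C) (uCart hu) ⥤ Cart (u ⋙ Arrow.rightFunc),
    L ⋙ uCart hu = StrictPullback.π₁ _ _ ⋙ CartRetract.evRetract C

variable [ChosenPullbacks C] [ChosenPushforwards C]

/-- The lift of the pushforward functor on composable triples `(r, q, p)` with `r` a structured
trivial fibration to composable pairs whose first arrow is a structured trivial fibration. -/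
def HasPushforwardLift : Prop :=
  ∃ L : StrictPullback (uCart hu) (CartTriple.ev01 C) ⥤
      StrictPullback (uCart hu) (CartPair.ev01 C),
    L ⋙ StrictPullback.π₂ _ _ = StrictPullback.π₂ _ _ ⋙ pushTriple

variable [HasTerminal C] (I : C)

/-- The category `Fib_cart` of structured fibrations: an arrow `p` together with a structured trivial
fibration over `δ ⇒ p`. -/
abbrev FibCart := StrictPullback (leibnizFunctor I) (uCart hu)

/-- The forgetful functor `Fib_cart ⥤ E^2_cart`. -/
noncomputable abbrev uFib : FibCart hu I ⥤ CartArrow C := StrictPullback.π₁ _ _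

/-- The category `Fib_cart ×_E Fib_cart` of composable pairs of structured fibrations. As `E^3_cart`
is the pullback of `E^2_cart` with itself over `cod` and `dom`, this is the pullback along
`E^3_cart ⥤ E^2_cart × E^2_cart`, `(q, p) ↦ (q, p)`, of two copies of `Fib_cart`. -/
abbrev FibPair :=
  StrictPullback ((uFib hu I).prod (uFib hu I)) ((CartPair.ev01 C).prod' (CartPair.ev12 C))

/-- The functor `u × u : Fib_cart ×_E Fib_cart ⥤ E^3_cart`. -/
noncomputable abbrev uFibPair : FibPair hu I ⥤ CartPair C := StrictPullback.π₂ _ _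

end Structured

end StructuredFrobenius

open StructuredFrobenius

/-!
Write `pr : X^I × I ⟶ X^I` for the projection. The universal property of the exponential says that
`r^I = pr_* (ε^* r)` for `r : R ⟶ X`, with `δ ⇒ r` as the counit; in other words, `δ ⇒ r`, `r^I` and
`pr` form a distributivity pullback in the sense of Weber. Distributivity pullbacks can be pushed
forward along pullback squares. For `q : B ⟶ A` and `p : A ⟶ X`, both `δ ⇒ p_* q` and
`(p^I × I)_* (δ ⇒ q)` are therefore counits of distributivity pullbacks around the projection from
`X^I × I`, so by their universal property the first is a retract of the second as soon as its
codomain `ε_X^* p_* B` is a retract of `(p^I × I)_* ε_A^* B` over `X^I × I`, naturally in `(q, p)`.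

The inclusion of that retract is the Beck–Chevalley map, which sends `y` over `(γ, i)` to
`(α, i) ↦ y (α i)`. By (TF1), `δ ⇒ p` has a section `σ`, which extends an element `a` of `A` over
`γ i` to a path `σ (a, γ, i)` in `A` over `γ` that passes through `a` at `i`, so that
`s ↦ (a ↦ s (σ (a, γ, i)))` is a retraction. By (TF2), `(p^I × I)_* (δ ⇒ q)` is structured, and by
(TF3) so is its retract `δ ⇒ p_* q`.
-/

namespace StructuredFrobenius

universe v u v₁ v₂ v₃ v₄ u₁ u₂ u₃ u₄

section Fibrations

variable {𝒮 : Type u} [Category.{v} 𝒮]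
variable {𝒳 : Type u₁} [Category.{v₁} 𝒳] {𝒴 : Type u₂} [Category.{v₂} 𝒴]

/-- `p` is a category fibred in groupoids: arrows of the base lift, and every arrow upstairs is
cartesian. The universal property of cartesian arrows is stated with equations rather than with
`IsHomLift`, which is equivalent and easier to compose. -/
structure IsFibredInGroupoids (p : 𝒳 ⥤ 𝒮) : Prop where
  exists_isHomLift : ∀ (X : 𝒳) {R : 𝒮} (f : R ⟶ p.obj X),
    ∃ (Y : 𝒳) (φ : Y ⟶ X), p.IsHomLift f φ
  existsUnique_fac : ∀ {X Y Z : 𝒳} (φ : X ⟶ Y) (ψ : Z ⟶ Y) (g : p.obj Z ⟶ p.obj X),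
    g ≫ p.map φ = p.map ψ → ∃! χ : Z ⟶ X, p.map χ = g ∧ χ ≫ φ = ψ

namespace IsFibredInGroupoids

lemma cartesianArrows {p : 𝒳 ⥤ 𝒮} (hp : IsFibredInGroupoids p) {X Y : 𝒳} (φ : X ⟶ Y) :
    cartesianArrows p φ where
  universal_property' {Z} g ψ _ := by
    obtain ⟨χ, ⟨hχ, hχφ⟩, hu⟩ :=
      hp.existsUnique_fac φ ψ g (IsHomLift.eq_of_isHomLift p (g ≫ p.map φ) ψ)
    refine ⟨χ, ⟨?_, hχφ⟩, fun χ' ⟨_, hχ'φ⟩ => hu χ' ⟨?_, hχ'φ⟩⟩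
    · subst hχ
      infer_instance
    · exact (IsHomLift.eq_of_isHomLift p g χ').symm

lemma isFibered {p : 𝒳 ⥤ 𝒮} (hp : IsFibredInGroupoids p) : p.IsFibered := by
  refine .of_exists_isStronglyCartesian fun X R f => ?_
  obtain ⟨Y, φ, hφ⟩ := hp.exists_isHomLift X f
  obtain rfl := IsHomLift.domain_eq p f φ
  obtain rfl := IsHomLift.eq_of_isHomLift p f φ
  exact ⟨Y, φ, hp.cartesianArrows φ⟩

lemma comp {F : 𝒳 ⥤ 𝒴} {p : 𝒴 ⥤ 𝒮} (hF : IsFibredInGroupoids F) (hp : IsFibredInGroupoids p) :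
    IsFibredInGroupoids (F ⋙ p) where
  exists_isHomLift X R f := by
    obtain ⟨Y, φ, hφ⟩ := hp.exists_isHomLift (F.obj X) f
    obtain rfl := IsHomLift.domain_eq p f φ
    obtain rfl := IsHomLift.eq_of_isHomLift p f φ
    obtain ⟨Z, ψ, hψ⟩ := hF.exists_isHomLift X φ
    obtain rfl := IsHomLift.domain_eq F φ ψ
    obtain rfl := IsHomLift.eq_of_isHomLift F φ ψ
    exact ⟨Z, ψ, IsHomLift.map (F ⋙ p) ψ⟩
  existsUnique_fac φ ψ g e := by
    obtain ⟨χ, ⟨hχ, hχφ⟩, hχu⟩ := hp.existsUnique_fac (F.map φ) (F.map ψ) g e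
    obtain ⟨ξ, ⟨hξ, hξφ⟩, hξu⟩ := hF.existsUnique_fac φ ψ χ hχφ
    refine ⟨ξ, ⟨(congrArg p.map hξ).trans hχ, hξφ⟩, fun ξ' ⟨h₁, h₂⟩ => hξu ξ' ⟨?_, h₂⟩⟩
    exact hχu _ ⟨h₁, by rw [← F.map_comp, h₂]⟩

end IsFibredInGroupoids

namespace IsDiscreteFibration

lemma of_exists_of_unique {F : 𝒳 ⥤ 𝒴}
    (hl : ∀ (X : 𝒳) {Y : 𝒴} (f : Y ⟶ F.obj X), ∃ (X' : 𝒳) (φ : X' ⟶ X), F.IsHomLift f φ)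
    (hu : ∀ {X X' X'' : 𝒳} (φ : X' ⟶ X) (ψ : X'' ⟶ X), F.IsHomLift (F.map φ) ψ →
      (⟨X'', ψ⟩ : Σ Z : 𝒳, (Z ⟶ X)) = ⟨X', φ⟩) :
    IsDiscreteFibration F := by
  intro X Y f
  obtain ⟨X', φ, hφ⟩ := hl X f
  obtain rfl := IsHomLift.domain_eq F f φ
  obtain rfl := IsHomLift.eq_of_isHomLift F f φ
  exact ⟨⟨X', φ⟩, hφ, fun ⟨_, ψ⟩ hψ => hu φ ψ hψ⟩

lemma lift_unique {F : 𝒳 ⥤ 𝒴} (hF : IsDiscreteFibration F) {X X' X'' : 𝒳} {Y : 𝒴}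
    {f : Y ⟶ F.obj X} {φ : X' ⟶ X} {ψ : X'' ⟶ X} (hφ : F.IsHomLift f φ) (hψ : F.IsHomLift f ψ) :
    (⟨X', φ⟩ : Σ Z : 𝒳, (Z ⟶ X)) = ⟨X'', ψ⟩ :=
  (hF X Y f).unique hφ hψ

lemma isFibredInGroupoids {F : 𝒳 ⥤ 𝒴} (hF : IsDiscreteFibration F) :
    IsFibredInGroupoids F where
  exists_isHomLift X R f := by
    obtain ⟨⟨Y, φ⟩, hφ, -⟩ := hF X R f
    exact ⟨Y, φ, hφ⟩
  existsUnique_fac {X Y Z} φ ψ g e := by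
    obtain ⟨⟨W, χ⟩, hχ, hu⟩ := hF X _ g
    have hψ : F.IsHomLift (g ≫ F.map φ) ψ := e ▸ IsHomLift.map F ψ
    have key := hF.lift_unique (IsHomLift.comp F g (F.map φ) χ φ) hψ
    obtain rfl : W = Z := congrArg Sigma.fst key
    refine ⟨χ, ⟨(IsHomLift.eq_of_isHomLift F g χ).symm, by simpa using key⟩, ?_⟩
    rintro χ' ⟨rfl, -⟩
    simpa using hu ⟨_, χ'⟩ (IsHomLift.map F χ')

end IsDiscreteFibration

end Fibrations

section StrictPullback

variable {𝒜 : Type u₁} [Category.{v₁} 𝒜] {ℬ : Type u₂} [Category.{v₂} ℬ]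
variable {𝒞 : Type u₃} [Category.{v₃} 𝒞] {𝒟 : Type u₄} [Category.{v₄} 𝒟]

lemma IsDiscreteFibration.prod {F : 𝒜 ⥤ 𝒞} {G : ℬ ⥤ 𝒟} (hF : IsDiscreteFibration F)
    (hG : IsDiscreteFibration G) : IsDiscreteFibration (F.prod G) := by
  refine .of_exists_of_unique ?_ ?_
  · rintro ⟨d₁, d₂⟩ ⟨b₁, b₂⟩ ⟨f₁, f₂⟩
    obtain ⟨⟨c₁, g₁⟩, h₁, -⟩ := hF d₁ b₁ f₁
    obtain ⟨⟨c₂, g₂⟩, h₂, -⟩ := hG d₂ b₂ f₂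
    obtain rfl := IsHomLift.domain_eq F f₁ g₁
    obtain rfl := IsHomLift.eq_of_isHomLift F f₁ g₁
    obtain rfl := IsHomLift.domain_eq G f₂ g₂
    obtain rfl := IsHomLift.eq_of_isHomLift G f₂ g₂
    exact ⟨(c₁, c₂), Prod.mkHom g₁ g₂, IsHomLift.map (F.prod G) (Prod.mkHom g₁ g₂)⟩
  · rintro ⟨d₁, d₂⟩ ⟨c₁, c₂⟩ ⟨e₁, e₂⟩ φ ψ hψ
    have hobj := IsHomLift.domain_eq (F.prod G) ((F.prod G).map φ) ψ
    have hmap := IsHomLift.fac' (F.prod G) ((F.prod G).map φ) ψ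
    have h₁ := hF.lift_unique (IsHomLift.map F φ.1)
      (IsHomLift.of_fac' F (F.map φ.1) ψ.1 (congrArg Prod.fst hobj) rfl
        (by simpa using congrArg Prod.fst hmap))
    have h₂ := hG.lift_unique (IsHomLift.map G φ.2)
      (IsHomLift.of_fac' G (G.map φ.2) ψ.2 (congrArg Prod.snd hobj) rfl
        (by simpa using congrArg Prod.snd hmap))
    obtain ⟨φ₁, φ₂⟩ := φ
    obtain ⟨ψ₁, ψ₂⟩ := ψ
    cases h₁
    cases h₂
    rfl

namespace StrictPullback

lemma isDiscreteFibration_π₁ (F : 𝒜 ⥤ 𝒞) {G : ℬ ⥤ 𝒞} (hG : IsDiscreteFibration G) :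
    IsDiscreteFibration (π₁ F G) := by
  refine .of_exists_of_unique ?_ ?_
  · rintro ⟨a, b, w⟩ a' (f : a' ⟶ a)
    obtain ⟨⟨b', g⟩, hg, -⟩ := hG b (F.obj a') (F.map f ≫ eqToHom w)
    have w' : F.obj a' = G.obj b' := (IsHomLift.domain_eq G (F.map f ≫ eqToHom w) g).symm
    let φ : (⟨a', b', w'⟩ : StrictPullback F G) ⟶ ⟨a, b, w⟩ :=
      ⟨f, g, by simpa using IsHomLift.fac G (F.map f ≫ eqToHom w) g⟩
    exact ⟨_, φ, IsHomLift.map (π₁ F G) φ⟩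
  · rintro ⟨a, b, w⟩ ⟨a', b', w'⟩ ⟨a'', b'', w''⟩ φ ψ hψ
    obtain rfl : a'' = a' := IsHomLift.domain_eq (π₁ F G) ((π₁ F G).map φ) ψ
    obtain ⟨φ₁, φ₂, hφ⟩ := φ
    obtain ⟨ψ₁, ψ₂, hψ'⟩ := ψ
    obtain rfl : φ₁ = ψ₁ := @IsHomLift.eq_of_isHomLift _ _ _ _ (π₁ F G) _ _ _ _ hψ
    have h := hG.lift_unique
      (IsHomLift.of_fac G (F.map φ₁ ≫ eqToHom w) φ₂ w'.symm rfl (by simpa using hφ))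
      (IsHomLift.of_fac G (F.map φ₁ ≫ eqToHom w) ψ₂ w''.symm rfl (by simpa using hψ'))
    cases h
    rfl

lemma isDiscreteFibration_π₂ {F : 𝒜 ⥤ 𝒞} (G : ℬ ⥤ 𝒞) (hF : IsDiscreteFibration F) :
    IsDiscreteFibration (π₂ F G) := by
  refine .of_exists_of_unique ?_ ?_
  · rintro ⟨a, b, w⟩ b' (f : b' ⟶ b)
    obtain ⟨⟨a', g⟩, hg, -⟩ := hF a (G.obj b') (G.map f ≫ eqToHom w.symm)
    have w' : F.obj a' = G.obj b' := IsHomLift.domain_eq F (G.map f ≫ eqToHom w.symm) g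
    let φ : (⟨a', b', w'⟩ : StrictPullback F G) ⟶ ⟨a, b, w⟩ :=
      ⟨g, f, by simp [IsHomLift.fac' F (G.map f ≫ eqToHom w.symm) g]⟩
    exact ⟨_, φ, IsHomLift.map (π₂ F G) φ⟩
  · rintro ⟨a, b, w⟩ ⟨a', b', w'⟩ ⟨a'', b'', w''⟩ φ ψ hψ
    obtain rfl : b'' = b' := IsHomLift.domain_eq (π₂ F G) ((π₂ F G).map φ) ψ
    obtain ⟨φ₁, φ₂, hφ⟩ := φ
    obtain ⟨ψ₁, ψ₂, hψ'⟩ := ψ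
    obtain rfl : φ₂ = ψ₂ := @IsHomLift.eq_of_isHomLift _ _ _ _ (π₂ F G) _ _ _ _ hψ
    have h := hF.lift_unique
      (IsHomLift.of_fac' F (G.map φ₂ ≫ eqToHom w.symm) φ₁ w' rfl
        (by simpa using (comp_eqToHom_iff w _ _).1 hφ))
      (IsHomLift.of_fac' F (G.map φ₂ ≫ eqToHom w.symm) ψ₁ w'' rfl
        (by simpa using (comp_eqToHom_iff w _ _).1 hψ'))
    cases h
    rfl

/-- The functor into a strict pullback given by its components. -/
def lift {F : 𝒜 ⥤ 𝒞} {G : ℬ ⥤ 𝒞} (K : 𝒟 ⥤ 𝒜) (L : 𝒟 ⥤ ℬ) (h : K ⋙ F = L ⋙ G) :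
    𝒟 ⥤ StrictPullback F G where
  obj X := ⟨K.obj X, L.obj X, Functor.congr_obj h X⟩
  map f := ⟨K.map f, L.map f, by
    have := Functor.congr_hom h f
    dsimp only [Functor.comp_obj, Functor.comp_map] at this
    simp [this]⟩
  map_id X := by apply Hom.ext; exacts [K.map_id X, L.map_id X]
  map_comp f g := by apply Hom.ext; exacts [K.map_comp f g, L.map_comp f g]

lemma π₁_comp (F : 𝒜 ⥤ 𝒞) (G : ℬ ⥤ 𝒞) : π₁ F G ⋙ F = π₂ F G ⋙ G :=
  CategoryTheory.Functor.ext (fun X => X.w) fun X Y f => by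
    rw [← Category.assoc]
    exact (comp_eqToHom_iff Y.w _ _).1 f.w

end StrictPullback

end StrictPullback

section Codomain

variable (C : Type u) [Category.{v} C]

variable {C} in
lemma exists_isPullback_of_fac {A X A' X' A'' X'' : C} {p : A ⟶ X} {p' : A' ⟶ X'}
    {p'' : A'' ⟶ X''} {a' : A' ⟶ A} {x' : X' ⟶ X} {a'' : A'' ⟶ A} {x'' : X'' ⟶ X}
    (h' : IsPullback a' p' p x') (h'' : IsPullback a'' p'' p x'') {g : X'' ⟶ X'}
    (e : g ≫ x' = x'') : ∃ l : A'' ⟶ A', l ≫ a' = a'' ∧ IsPullback l p'' p' g := by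
  subst e
  have w : a'' ≫ p = (p'' ≫ g) ≫ x' := by rw [Category.assoc, h''.w]
  refine ⟨h'.lift a'' (p'' ≫ g) w, h'.lift_fst _ _ _, .of_right ?_ (h'.lift_snd _ _ _) h'⟩
  rwa [h'.lift_fst]

variable [HasPullbacks C]

lemma CartArrow.isFibredInGroupoids_cod : IsFibredInGroupoids (CartArrow.cod C) where
  exists_isHomLift X R f := by
    let φ := CartArrow.homOf (IsPullback.of_hasPullback X.obj.hom f)
    exact ⟨_, φ, IsHomLift.map (CartArrow.cod C) φ⟩
  existsUnique_fac φ ψ g e := by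
    obtain ⟨l, hl, hp⟩ := exists_isPullback_of_fac φ.property ψ.property e
    refine ⟨⟨Arrow.homMk l g hp.w, hp⟩,
      ⟨rfl, WideSubcategory.hom_ext _ (Arrow.hom_ext _ _ hl e)⟩, ?_⟩
    rintro χ ⟨rfl, rfl⟩
    exact WideSubcategory.hom_ext _ (Arrow.hom_ext _ _
      (φ.property.hom_ext hl.symm (χ.property.w.trans hp.w.symm)) rfl)

lemma CartPair.isFibredInGroupoids_cod : IsFibredInGroupoids (CartPair.cod C) where
  exists_isHomLift X R f := by
    let φ : CartPair.mk _ _ ⟶ X := ⟨_, _, f, IsPullback.of_hasPullback X.q (pullback.fst X.p f),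
      IsPullback.of_hasPullback X.p f⟩
    exact ⟨_, φ, IsHomLift.map (CartPair.cod C) φ⟩
  existsUnique_fac φ ψ g e := by
    obtain ⟨a, ha, pa⟩ := exists_isPullback_of_fac φ.isPullback_p ψ.isPullback_p e
    obtain ⟨b, hb, pb⟩ := exists_isPullback_of_fac φ.isPullback_q ψ.isPullback_q ha
    refine ⟨⟨b, a, g, pb, pa⟩, ⟨rfl, CartPair.Hom.ext hb ha e⟩, ?_⟩
    rintro χ ⟨rfl, rfl⟩
    obtain rfl : χ.a = a := φ.isPullback_p.hom_ext ha.symm (χ.isPullback_p.w.trans pa.w.symm)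
    exact CartPair.Hom.ext
      (φ.isPullback_q.hom_ext hb.symm (χ.isPullback_q.w.trans pb.w.symm)) rfl rfl

end Codomain

section GeneralizedElements

open ChosenPullbacksAlong ExponentiableMorphism

variable {C : Type u} [Category.{v} C] [ChosenPullbacks C] [ChosenPushforwards C]

/-- The value in `B` of a generalized element `y` of `p_* B` at a generalized element `a` of `A`
over the same generalized element of `X`. -/
def pushApp {B A X : C} (q : B ⟶ A) (p : A ⟶ X) {V : C} (y : V ⟶ (push q p).left) (a : V ⟶ A)
    (h : y ≫ (push q p).hom = a ≫ p) : V ⟶ B :=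
  lift (f := (push q p).hom) (g := p) y a h ≫ pushEv q p

section

variable {B A X : C} (q : B ⟶ A) (p : A ⟶ X)

lemma pushEval_eq_pushApp {W V : C} (m : W ⟶ (push q p).left)
    (v₁ : V ⟶ W) (v₂ : V ⟶ A) (h : v₁ ≫ m ≫ (push q p).hom = v₂ ≫ p) :
    pushEval q p m v₁ v₂ h = pushApp q p (v₁ ≫ m) v₂ (by rw [Category.assoc, h]) := rfl

lemma pushApp_comp {V : C} (y : V ⟶ (push q p).left) (a : V ⟶ A)
    (h : y ≫ (push q p).hom = a ≫ p) : pushApp q p y a h ≫ q = a := by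
  rw [pushApp, Category.assoc, pushEv_comp, lift_snd _ _ _]

lemma comp_pushApp {V V' : C} (t : V' ⟶ V) (y : V ⟶ (push q p).left) (a : V ⟶ A)
    (h : y ≫ (push q p).hom = a ≫ p) :
    t ≫ pushApp q p y a h = pushApp q p (t ≫ y) (t ≫ a)
      (by rw [Category.assoc, h, Category.assoc]) := by
  rw [pushApp, pushApp, ← Category.assoc]
  congr 1
  apply ChosenPullbacksAlong.hom_ext <;> simp

lemma pushApp_congr {V : C} {y y' : V ⟶ (push q p).left} {a a' : V ⟶ A}
    {h : y ≫ (push q p).hom = a ≫ p} {h' : y' ≫ (push q p).hom = a' ≫ p}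
    (hy : y = y') (ha : a = a') : pushApp q p y a h = pushApp q p y' a' h' := by
  subst hy ha
  rfl

lemma exists_push_lift {W V : C} {w : W ⟶ X} {v₁ : V ⟶ W} {v₂ : V ⟶ A}
    (hV : IsPullback v₁ v₂ w p) (b : V ⟶ B) (hb : b ≫ q = v₂) :
    ∃ m : W ⟶ (push q p).left, m ≫ (push q p).hom = w ∧
      ∀ {V' : C} (t : V' ⟶ W) (a : V' ⟶ A) (h : (t ≫ m) ≫ (push q p).hom = a ≫ p)
        (h' : t ≫ w = a ≫ p), pushApp q p (t ≫ m) a h = hV.lift t a h' ≫ b := by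
  obtain ⟨m, hm, e⟩ := push_exists q p hV b hb
  refine ⟨m, hm, fun t a h h' => ?_⟩
  rw [← e, pushEval_eq_pushApp, comp_pushApp]
  apply pushApp_congr
  · rw [← Category.assoc, hV.lift_fst]
  · rw [hV.lift_snd]

/-- The generalized element of `p_* B` over `w` that is transpose to a map `b` into `B` from a
pullback of `p` along `w`. -/
noncomputable def pushLift {W V : C} {w : W ⟶ X} {v₁ : V ⟶ W} {v₂ : V ⟶ A}
    (hV : IsPullback v₁ v₂ w p) (b : V ⟶ B) (hb : b ≫ q = v₂) : W ⟶ (push q p).left :=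
  (exists_push_lift q p hV b hb).choose

section

variable {W V : C} {w : W ⟶ X} {v₁ : V ⟶ W} {v₂ : V ⟶ A} (hV : IsPullback v₁ v₂ w p)
  (b : V ⟶ B) (hb : b ≫ q = v₂)

lemma pushLift_hom : pushLift q p hV b hb ≫ (push q p).hom = w :=
  (exists_push_lift q p hV b hb).choose_spec.1

lemma pushApp_pushLift {V' : C} (t : V' ⟶ W) (a : V' ⟶ A)
    (h : (t ≫ pushLift q p hV b hb) ≫ (push q p).hom = a ≫ p) (h' : t ≫ w = a ≫ p) :
    pushApp q p (t ≫ pushLift q p hV b hb) a h = hV.lift t a h' ≫ b :=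
  (exists_push_lift q p hV b hb).choose_spec.2 t a h h'

end

lemma push_ext {W : C} {m m' : W ⟶ (push q p).left}
    (hm : m ≫ (push q p).hom = m' ≫ (push q p).hom)
    (e : ∀ {V : C} (t : V ⟶ W) (a : V ⟶ A) (h : (t ≫ m) ≫ (push q p).hom = a ≫ p)
      (h' : (t ≫ m') ≫ (push q p).hom = a ≫ p),
      pushApp q p (t ≫ m) a h = pushApp q p (t ≫ m') a h') : m = m' :=
  push_hom_ext q p (isPullback (m ≫ (push q p).hom) p) hm.symm (e _ _ _ _)

lemma pushApp_pushArrow {D : C} (r : D ⟶ B) {V : C} (y : V ⟶ (push (r ≫ q) p).left)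
    (a : V ⟶ A) (h : (y ≫ pushArrow r q p) ≫ (push q p).hom = a ≫ p)
    (h' : y ≫ (push (r ≫ q) p).hom = a ≫ p) :
    pushApp q p (y ≫ pushArrow r q p) a h = pushApp (r ≫ q) p y a h' ≫ r := by
  have := pushEval_pushArrow r q p y (𝟙 _) a (by rw [Category.id_comp, h'])
  rw [pushEval_eq_pushApp, pushEval_eq_pushApp] at this
  refine Eq.trans (pushApp_congr q p (Category.id_comp _).symm rfl) (this.trans ?_)
  exact congrArg (· ≫ r) (pushApp_congr (r ≫ q) p (Category.id_comp _) rfl)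

end

lemma pushApp_pushMap {S T : CartPair C} (f : S ⟶ T) {V : C} (y : V ⟶ (push S.q S.p).left)
    (a : V ⟶ S.A) {a' : V ⟶ T.A} (ha : a' = a ≫ f.a)
    (h : (y ≫ pushMap f) ≫ (push T.q T.p).hom = a' ≫ T.p)
    (h' : y ≫ (push S.q S.p).hom = a ≫ S.p) :
    pushApp T.q T.p (y ≫ pushMap f) a' h = pushApp S.q S.p y a h' ≫ f.b := by
  subst ha
  have := pushEval_pushMap f y (𝟙 _) a (by rw [Category.id_comp, h'])
  rw [pushEval_eq_pushApp, pushEval_eq_pushApp] at this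
  refine Eq.trans (pushApp_congr _ _ (Category.id_comp _).symm rfl) (this.trans ?_)
  exact congrArg (· ≫ f.b) (pushApp_congr _ _ (Category.id_comp _) rfl)

lemma push_ext_of_hom {S T : CartPair C} (f : S ⟶ T) {W : C} {m m' : W ⟶ (push T.q T.p).left}
    {w : W ⟶ S.X} (hm : m ≫ (push T.q T.p).hom = w ≫ f.x)
    (hm' : m' ≫ (push T.q T.p).hom = w ≫ f.x)
    (e : ∀ {V : C} (t : V ⟶ W) (a : V ⟶ S.A) (_ : t ≫ w = a ≫ S.p)
      (h : (t ≫ m) ≫ (push T.q T.p).hom = (a ≫ f.a) ≫ T.p)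
      (h' : (t ≫ m') ≫ (push T.q T.p).hom = (a ≫ f.a) ≫ T.p),
      pushApp T.q T.p (t ≫ m) (a ≫ f.a) h = pushApp T.q T.p (t ≫ m') (a ≫ f.a) h') :
    m = m' := by
  refine push_ext _ _ (hm.trans hm'.symm) fun t a h h' => ?_
  have ha : a ≫ T.p = (t ≫ w) ≫ f.x := by
    rw [← h, Category.assoc, Category.assoc, hm]
  have := e t (f.isPullback_p.lift a (t ≫ w) ha) (f.isPullback_p.lift_snd _ _ _).symm
    (by rw [f.isPullback_p.lift_fst, h]) (by rw [f.isPullback_p.lift_fst, h'])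
  refine Eq.trans (pushApp_congr _ _ rfl ?_) (this.trans (pushApp_congr _ _ rfl ?_))
  · rw [f.isPullback_p.lift_fst]
  · rw [f.isPullback_p.lift_fst]

end GeneralizedElements

section BeckChevalley

open ChosenPullbacksAlong ExponentiableMorphism

variable {C : Type u} [Category.{v} C]

/-- The data that give rise to a Beck–Chevalley map `x^* p_* B ⟶ p'_* B'`: a commutative square from
`p'` to `p`, not necessarily a pullback, and over it a pullback square from `q'` to `q`. -/
structure BeckChevalleySquare (S' S : CartPair C) where
  b : S'.B ⟶ S.B
  a : S'.A ⟶ S.A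
  x : S'.X ⟶ S.X
  w : a ≫ S.p = S'.p ≫ x
  isPullback_q : IsPullback b S'.q S.q a

namespace BeckChevalleySquare

variable [ChosenPullbacks C]

section

variable {S' S : CartPair C} (Q : BeckChevalleySquare S' S)

/-- The comparison of the domain of `p'` with the pullback of `p`. -/
def gap : S'.A ⟶ pullbackObj S.p Q.x := lift Q.a S'.p Q.w

lemma gap_fst : Q.gap ≫ fst S.p Q.x = Q.a := lift_fst _ _ _

lemma gap_snd : Q.gap ≫ snd S.p Q.x = S'.p := lift_snd _ _ _

variable [ChosenPushforwards C]

lemma condition_comp {V : C} (t : V ⟶ pullbackObj (push S.q S.p).hom Q.x) (a : V ⟶ S'.A)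
    (h : t ≫ snd _ _ = a ≫ S'.p) : (t ≫ fst _ _) ≫ (push S.q S.p).hom = (a ≫ Q.a) ≫ S.p := by
  rw [Category.assoc, condition, reassoc_of% h, Category.assoc, Q.w]

/-- The Beck–Chevalley map, sending `y` over `x(x')` to `a' ↦ y (a(a'))`. -/
noncomputable def comparison :
    pullbackObj (push S.q S.p).hom Q.x ⟶ (push S'.q S'.p).left :=
  pushLift S'.q S'.p (isPullback (snd (push S.q S.p).hom Q.x) S'.p)
    (Q.isPullback_q.lift (pushApp S.q S.p (fst _ _ ≫ fst _ _) (snd _ _ ≫ Q.a)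
      (Q.condition_comp _ _ condition)) (snd _ _) (pushApp_comp _ _ _ _ _))
    (Q.isPullback_q.lift_snd _ _ _)

lemma comparison_hom : Q.comparison ≫ (push S'.q S'.p).hom = snd (push S.q S.p).hom Q.x :=
  pushLift_hom _ _ _ _ _

lemma pushApp_comparison {V : C} (t : V ⟶ pullbackObj (push S.q S.p).hom Q.x) (a : V ⟶ S'.A)
    (h : (t ≫ Q.comparison) ≫ (push S'.q S'.p).hom = a ≫ S'.p) (h' : t ≫ snd _ _ = a ≫ S'.p) :
    pushApp S'.q S'.p (t ≫ Q.comparison) a h ≫ Q.b =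
      pushApp S.q S.p (t ≫ fst _ _) (a ≫ Q.a) (Q.condition_comp t a h') := by
  refine (congrArg (· ≫ Q.b) (pushApp_pushLift _ _ _ _ _ t a h h')).trans ?_
  rw [Category.assoc, Q.isPullback_q.lift_fst, comp_pushApp]
  apply pushApp_congr
  · rw [← Category.assoc, IsPullback.lift_fst]
  · rw [← Category.assoc, IsPullback.lift_snd]

end

section

variable {S' S : CartPair C} (Q : BeckChevalleySquare S' S) {σ : pullbackObj S.p Q.x ⟶ S'.A}

/-- The value of a section `σ` of the gap map at generalized elements `a` of `A` and `x'` of `X'`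
over the same element of `X`. -/
def sectionAt (_ : σ ≫ Q.gap = 𝟙 _) {V : C} (a : V ⟶ S.A) (x' : V ⟶ S'.X)
    (h : a ≫ S.p = x' ≫ Q.x) : V ⟶ S'.A :=
  lift a x' h ≫ σ

variable (hσ : σ ≫ Q.gap = 𝟙 _)

lemma sectionAt_a {V : C} (a : V ⟶ S.A) (x' : V ⟶ S'.X) (h : a ≫ S.p = x' ≫ Q.x) :
    Q.sectionAt hσ a x' h ≫ Q.a = a := by
  rw [sectionAt, ← Q.gap_fst, Category.assoc, reassoc_of% hσ, lift_fst _ _ _]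

lemma sectionAt_p {V : C} (a : V ⟶ S.A) (x' : V ⟶ S'.X) (h : a ≫ S.p = x' ≫ Q.x) :
    Q.sectionAt hσ a x' h ≫ S'.p = x' := by
  rw [sectionAt, ← Q.gap_snd, Category.assoc, reassoc_of% hσ, lift_snd _ _ _]

lemma comp_sectionAt {V V' : C} (t : V' ⟶ V) (a : V ⟶ S.A) (x' : V ⟶ S'.X)
    (h : a ≫ S.p = x' ≫ Q.x) :
    t ≫ Q.sectionAt hσ a x' h =
      Q.sectionAt hσ (t ≫ a) (t ≫ x') (by simp only [Category.assoc, h]) := by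
  rw [sectionAt, sectionAt, ← Category.assoc]
  congr 1
  apply ChosenPullbacksAlong.hom_ext <;> simp

variable [ChosenPushforwards C]

lemma exists_retraction :
    ∃ m : (push S'.q S'.p).left ⟶ (push S.q S.p).left,
      m ≫ (push S.q S.p).hom = (push S'.q S'.p).hom ≫ Q.x ∧
      ∀ {V : C} (s : V ⟶ (push S'.q S'.p).left) (a : V ⟶ S.A)
        (h : (s ≫ m) ≫ (push S.q S.p).hom = a ≫ S.p)
        (h' : a ≫ S.p = (s ≫ (push S'.q S'.p).hom) ≫ Q.x),
        pushApp S.q S.p (s ≫ m) a h =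
          pushApp S'.q S'.p s (Q.sectionAt hσ a (s ≫ (push S'.q S'.p).hom) h')
            (Q.sectionAt_p hσ _ _ _).symm ≫ Q.b := by
  have hV := isPullback ((push S'.q S'.p).hom ≫ Q.x) S.p
  let s₀ := fst ((push S'.q S'.p).hom ≫ Q.x) S.p
  have h₀ : snd _ _ ≫ S.p = (s₀ ≫ (push S'.q S'.p).hom) ≫ Q.x := by
    rw [Category.assoc, ← hV.w]
  let b := pushApp S'.q S'.p s₀ (Q.sectionAt hσ _ _ h₀) (Q.sectionAt_p hσ _ _ _).symm ≫ Q.b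
  have hb : b ≫ S.q = snd _ _ := by
    rw [Category.assoc, Q.isPullback_q.w, ← Category.assoc, pushApp_comp, sectionAt_a]
  refine ⟨pushLift S.q S.p hV b hb, pushLift_hom _ _ _ _ _, fun s a h h' => ?_⟩
  rw [pushApp_pushLift _ _ _ _ _ _ _ _ (by rw [h', Category.assoc]), ← Category.assoc,
    comp_pushApp]
  congr 1
  refine pushApp_congr _ _ (hV.lift_fst _ _ _) ?_
  rw [comp_sectionAt]
  congr 1
  · exact hV.lift_snd _ _ _
  · rw [← Category.assoc, hV.lift_fst]

/-- The map to the pullback `x^* p_* B` sending `s` over `x'` to `a ↦ s (σ (a, x'))`. -/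
noncomputable def retraction :
    (push S'.q S'.p).left ⟶ pullbackObj (push S.q S.p).hom Q.x :=
  lift (Q.exists_retraction hσ).choose (push S'.q S'.p).hom (Q.exists_retraction hσ).choose_spec.1

lemma retraction_snd : Q.retraction hσ ≫ snd _ _ = (push S'.q S'.p).hom := lift_snd _ _ _

lemma pushApp_retraction {V : C} (s : V ⟶ (push S'.q S'.p).left) (a : V ⟶ S.A)
    (h : (s ≫ Q.retraction hσ ≫ fst _ _) ≫ (push S.q S.p).hom = a ≫ S.p)
    (h' : a ≫ S.p = (s ≫ (push S'.q S'.p).hom) ≫ Q.x) :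
    pushApp S.q S.p (s ≫ Q.retraction hσ ≫ fst _ _) a h =
      pushApp S'.q S'.p s (Q.sectionAt hσ a _ h') (Q.sectionAt_p hσ _ _ _).symm ≫ Q.b := by
  obtain ⟨hm, e⟩ := (Q.exists_retraction hσ).choose_spec
  rw [← e s a (by rw [Category.assoc, hm, h', Category.assoc]) h']
  exact pushApp_congr _ _ (congrArg (s ≫ ·) (lift_fst _ _ _)) rfl

lemma comparison_retraction : Q.comparison ≫ Q.retraction hσ = 𝟙 _ := by
  apply ChosenPullbacksAlong.hom_ext
  · refine push_ext _ _ ?_ fun t a h h' => ?_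
    · simp [condition, reassoc_of% Q.retraction_snd hσ, reassoc_of% Q.comparison_hom]
    · have ha : a ≫ S.p = ((t ≫ Q.comparison) ≫ (push S'.q S'.p).hom) ≫ Q.x := by
        simp only [Q.comparison_hom, ← h', Category.assoc, Category.id_comp, condition]
      have e : t ≫ (Q.comparison ≫ Q.retraction hσ) ≫ fst _ _ =
        (t ≫ Q.comparison) ≫ Q.retraction hσ ≫ fst _ _ := by simp only [Category.assoc]
      rw [pushApp_congr _ _ (h' := by rw [← e, h]) e rfl, Q.pushApp_retraction hσ _ _ _ ha,
        Q.pushApp_comparison _ _ _ (by rw [sectionAt_p, Category.assoc, comparison_hom])]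
      exact pushApp_congr _ _ (by rw [Category.id_comp]) (Q.sectionAt_a hσ _ _ _)
  · rw [Category.assoc, retraction_snd, comparison_hom, Category.id_comp]

end

section Naturality

variable {S' S T' T : CartPair C} {Q : BeckChevalleySquare S' S} {R : BeckChevalleySquare T' T}
  {f : S ⟶ T} {f' : S' ⟶ T'} (hb : f'.b ≫ R.b = Q.b ≫ f.b) (ha : f'.a ≫ R.a = Q.a ≫ f.a)
  (hx : f'.x ≫ R.x = Q.x ≫ f.x)

variable [ChosenPushforwards C]

include hb ha in
lemma comparison_naturality :
    pullbackMap _ _ _ _ (pushMap f) f'.x f.x (pushMap_hom f).symm hx.symm ≫ R.comparison =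
      Q.comparison ≫ pushMap f' := by
  have hfst := pullbackMap_fst (pushMap_hom f).symm hx.symm
  have hsnd := pullbackMap_snd (pushMap_hom f).symm hx.symm
  refine push_ext_of_hom f' (w := snd _ _) ?_ ?_ fun t a hta h h' => ?_
  · rw [Category.assoc, comparison_hom, hsnd]
  · rw [Category.assoc, pushMap_hom, ← Category.assoc, comparison_hom]
  · have hQ : (t ≫ Q.comparison) ≫ (push S'.q S'.p).hom = a ≫ S'.p := by
      rw [Category.assoc, comparison_hom, hta]
    apply R.isPullback_q.hom_ext
    · have hy : (t ≫ fst _ _ ≫ pushMap f) ≫ (push T.q T.p).hom = ((a ≫ Q.a) ≫ f.a) ≫ T.p := by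
        rw [Category.assoc, Category.assoc, pushMap_hom, Category.assoc _ f.a,
          f.isPullback_p.w, reassoc_of% Q.condition_comp t a hta]
        simp only [Category.assoc]
      simp only [← Category.assoc] at h h' hy ⊢
      rw [R.pushApp_comparison _ _ _
          (by rw [Category.assoc, hsnd, reassoc_of% hta, Category.assoc, f'.isPullback_p.w]),
        pushApp_pushMap f' _ _ rfl _ hQ]
      refine (pushApp_congr _ _ ?_ ?_).trans
        ((pushApp_pushMap f _ (a ≫ Q.a) rfl hy (Q.condition_comp t a hta)).trans ?_)
      · rw [Category.assoc, hfst, Category.assoc]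
      · rw [Category.assoc, ha, Category.assoc]
      · rw [← Q.pushApp_comparison t a hQ hta, Category.assoc, ← hb, Category.assoc]
    · rw [pushApp_comp, pushApp_comp]

variable {σ : pullbackObj S.p Q.x ⟶ S'.A} {τ : pullbackObj T.p R.x ⟶ T'.A}
  (hσ : σ ≫ Q.gap = 𝟙 _) (hτ : τ ≫ R.gap = 𝟙 _)
  (hn : σ ≫ f'.a = pullbackMap _ _ _ _ f.a f'.x f.x f.isPullback_p.w.symm hx.symm ≫ τ)

include hn in
omit [ChosenPushforwards C] in
lemma sectionAt_naturality {V : C} (a : V ⟶ S.A) (x' : V ⟶ S'.X) (h : a ≫ S.p = x' ≫ Q.x) :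
    Q.sectionAt hσ a x' h ≫ f'.a = R.sectionAt hτ (a ≫ f.a) (x' ≫ f'.x) (by
      rw [Category.assoc, f.isPullback_p.w, reassoc_of% h, Category.assoc, hx]) := by
  rw [sectionAt, sectionAt, Category.assoc, hn, ← Category.assoc]
  congr 1
  apply ChosenPullbacksAlong.hom_ext <;> simp

include hb hn in
lemma retraction_naturality :
    pushMap f' ≫ R.retraction hτ = Q.retraction hσ ≫
      pullbackMap _ _ _ _ (pushMap f) f'.x f.x (pushMap_hom f).symm hx.symm := by
  have hfst := pullbackMap_fst (pushMap_hom f).symm hx.symm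
  have hsnd := pullbackMap_snd (pushMap_hom f).symm hx.symm
  apply ChosenPullbacksAlong.hom_ext
  · refine push_ext_of_hom f (w := (push S'.q S'.p).hom ≫ Q.x) ?_ ?_ fun t a hta h h' => ?_
    · rw [Category.assoc, Category.assoc, condition, reassoc_of% R.retraction_snd hτ,
        reassoc_of% pushMap_hom f', hx, Category.assoc]
    · rw [Category.assoc (Q.retraction hσ), hfst, Category.assoc, Category.assoc, pushMap_hom,
        condition_assoc, reassoc_of% Q.retraction_snd hσ, Category.assoc]
    · have hta' : a ≫ S.p = (t ≫ (push S'.q S'.p).hom) ≫ Q.x := by rw [← hta, Category.assoc]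
      have hτa : (a ≫ f.a) ≫ T.p = ((t ≫ pushMap f') ≫ (push T'.q T'.p).hom) ≫ R.x := by
        rw [Category.assoc, f.isPullback_p.w, reassoc_of% hta', Category.assoc t, pushMap_hom]
        simp only [Category.assoc, hx]
      have hy : (t ≫ Q.retraction hσ ≫ fst _ _) ≫ (push S.q S.p).hom = a ≫ S.p := by
        rw [hta', Category.assoc, Category.assoc, condition, reassoc_of% Q.retraction_snd hσ,
          Category.assoc]
      have hs : R.sectionAt hτ (a ≫ f.a) _ hτa = Q.sectionAt hσ a _ hta' ≫ f'.a := by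
        simp only [Q.sectionAt_naturality hx hσ hτ hn, Category.assoc, pushMap_hom]
      calc
        _ = pushApp T.q T.p ((t ≫ pushMap f') ≫ R.retraction hτ ≫ fst _ _) (a ≫ f.a) _ :=
          pushApp_congr _ _ (h' := by simpa only [Category.assoc] using h)
            (by simp only [Category.assoc]) rfl
        _ = (pushApp S'.q S'.p t (Q.sectionAt hσ a _ hta') (Q.sectionAt_p hσ _ _ _).symm ≫
            f'.b) ≫ R.b := by
          rw [R.pushApp_retraction hτ _ _ _ hτa, pushApp_pushMap f' _ _ hs]
        _ = pushApp S.q S.p (t ≫ Q.retraction hσ ≫ fst _ _) a hy ≫ f.b := by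
          rw [Q.pushApp_retraction hσ _ _ _ hta', Category.assoc, hb, Category.assoc]
        _ = _ := by
          have e : (t ≫ Q.retraction hσ ≫ fst _ _) ≫ pushMap f =
              t ≫ (Q.retraction hσ ≫ pullbackMap _ _ _ _ (pushMap f) f'.x f.x
                (pushMap_hom f).symm hx.symm) ≫ fst _ _ := by
            simp only [Category.assoc, hfst]
          rw [← pushApp_pushMap f _ a rfl (by rw [e, h'])]
          exact pushApp_congr _ _ e rfl
  · rw [Category.assoc, retraction_snd, Category.assoc, hsnd, reassoc_of% Q.retraction_snd hσ,
      pushMap_hom]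

end Naturality

end BeckChevalleySquare

end BeckChevalley

section DistributivityPullback

open ExponentiableMorphism

variable (C : Type u) [Category.{v} C]

/-- A distributivity pullback around `E ⟶ Z ⟶ Y` in the sense of Weber: `F` is the pushforward of
`E` along `π`, given by its universal property, `D` is its pullback along `π`, and `d` is the
counit. -/
structure DistributivityPullback where
  {D E Z F Y : C}
  d : D ⟶ E
  e : E ⟶ Z
  π : Z ⟶ Y
  κ : D ⟶ F
  f : F ⟶ Y
  isPullback : IsPullback κ (d ≫ e) f π
  existsUnique_lift {W K : C} {w : W ⟶ Y} {k₁ : K ⟶ W} {k₂ : K ⟶ Z}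
    (hK : IsPullback k₁ k₂ w π) (g : K ⟶ E) (hg : g ≫ e = k₂) :
    ∃! n : W ⟶ F, n ≫ f = w ∧ ∃ m : K ⟶ D, m ≫ κ = k₁ ≫ n ∧ m ≫ d = g

variable {C} in
lemma isPullback_of_cube {W WA K KA Y Y' Z Z' : C} {π : Z ⟶ Y} {P : Z ⟶ Z'} {ϖ : Y ⟶ Y'}
    {π' : Z' ⟶ Y'} {w : W ⟶ Y'} {k₁ : K ⟶ W} {k₂ : K ⟶ Z'} {w₁ : WA ⟶ W} {w₂ : WA ⟶ Y}
    {c₁ : KA ⟶ K} {c₂ : KA ⟶ Z} {k : KA ⟶ WA} (w_bot : π ≫ ϖ = P ≫ π')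
    (hK : IsPullback k₁ k₂ w π') (hWA : IsPullback w₁ w₂ w ϖ) (hKA : IsPullback c₁ c₂ k₂ P)
    (hk₁ : k ≫ w₁ = c₁ ≫ k₁) (hk₂ : k ≫ w₂ = c₂ ≫ π) : IsPullback k c₂ w₂ π := by
  refine IsPullback.of_right ?_ hk₂ hWA
  rw [hk₁, w_bot]
  exact hKA.paste_horiz hK

namespace DistributivityPullback

variable {C}

/-- Maps of distributivity pullbacks over pullback squares from `π` to `π'`. -/
structure Hom (S T : DistributivityPullback C) where
  d : S.D ⟶ T.D
  e : S.E ⟶ T.E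
  z : S.Z ⟶ T.Z
  f : S.F ⟶ T.F
  y : S.Y ⟶ T.Y
  w_d : d ≫ T.d = S.d ≫ e
  w_e : e ≫ T.e = S.e ≫ z
  w_κ : d ≫ T.κ = S.κ ≫ f
  w_f : f ≫ T.f = S.f ≫ y
  isPullback : IsPullback z S.π T.π y

lemma Hom.isPullback_comp {S T : DistributivityPullback C} {z : S.Z ⟶ T.Z} {y : S.Y ⟶ T.Y}
    (h : IsPullback z S.π T.π y) : IsPullback S.κ ((S.d ≫ S.e) ≫ z) (S.f ≫ y) T.π :=
  (S.isPullback.flip.paste_horiz h).flip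

@[ext]
lemma Hom.ext {S T : DistributivityPullback C} {φ ψ : Hom S T} (he : φ.e = ψ.e) (hz : φ.z = ψ.z)
    (hy : φ.y = ψ.y) : φ = ψ := by
  have hf : φ.f = ψ.f := by
    refine (T.existsUnique_lift (Hom.isPullback_comp φ.isPullback) (S.d ≫ φ.e) ?_).unique
      ⟨φ.w_f, φ.d, φ.w_κ, φ.w_d⟩ ⟨hy ▸ ψ.w_f, ψ.d, ψ.w_κ, he ▸ ψ.w_d⟩
    rw [Category.assoc, φ.w_e, Category.assoc]
  have hd : φ.d = ψ.d := by
    apply T.isPullback.hom_ext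
    · rw [φ.w_κ, ψ.w_κ, hf]
    · rw [reassoc_of% φ.w_d, reassoc_of% ψ.w_d, he]
  cases φ; cases ψ; congr

instance : Category (DistributivityPullback C) where
  Hom := Hom
  id S := ⟨𝟙 _, 𝟙 _, 𝟙 _, 𝟙 _, 𝟙 _, by simp, by simp, by simp, by simp, .of_horiz_isIso ⟨by simp⟩⟩
  comp φ ψ :=
    { d := φ.d ≫ ψ.d
      e := φ.e ≫ ψ.e
      z := φ.z ≫ ψ.z
      f := φ.f ≫ ψ.f
      y := φ.y ≫ ψ.y
      w_d := by rw [Category.assoc, ψ.w_d, reassoc_of% φ.w_d]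
      w_e := by rw [Category.assoc, ψ.w_e, reassoc_of% φ.w_e]
      w_κ := by rw [Category.assoc, ψ.w_κ, reassoc_of% φ.w_κ]
      w_f := by rw [Category.assoc, ψ.w_f, reassoc_of% φ.w_f]
      isPullback := φ.isPullback.paste_horiz ψ.isPullback }
  id_comp φ := Hom.ext (Category.id_comp _) (Category.id_comp _) (Category.id_comp _)
  comp_id φ := Hom.ext (Category.comp_id _) (Category.comp_id _) (Category.comp_id _)
  assoc φ ψ χ := Hom.ext (Category.assoc _ _ _) (Category.assoc _ _ _) (Category.assoc _ _ _)

variable (C) in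
/-- The counits `D ⟶ E` of distributivity pullbacks. -/
def counit : DistributivityPullback C ⥤ Arrow C where
  obj S := Arrow.mk S.d
  map φ := Arrow.homMk φ.d φ.e φ.w_d

section HomMk

variable {S T : DistributivityPullback C} (e : S.E ⟶ T.E) (z : S.Z ⟶ T.Z) (y : S.Y ⟶ T.Y)
  (w : e ≫ T.e = S.e ≫ z) (h : IsPullback z S.π T.π y)

include w h in
lemma exists_hom_f : ∃ f : S.F ⟶ T.F, f ≫ T.f = S.f ≫ y ∧
    ∃ d : S.D ⟶ T.D, d ≫ T.κ = S.κ ≫ f ∧ d ≫ T.d = S.d ≫ e :=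
  (T.existsUnique_lift (Hom.isPullback_comp h) (S.d ≫ e)
    (by rw [Category.assoc, w, Category.assoc])).exists

/-- The map of distributivity pullbacks induced by a map `(e, z, y)` of the composable pairs that
they are around. -/
noncomputable def homMk : S ⟶ T where
  d := (exists_hom_f e z y w h).choose_spec.2.choose
  e := e
  z := z
  f := (exists_hom_f e z y w h).choose
  y := y
  w_d := (exists_hom_f e z y w h).choose_spec.2.choose_spec.2
  w_e := w
  w_κ := (exists_hom_f e z y w h).choose_spec.2.choose_spec.1
  w_f := (exists_hom_f e z y w h).choose_spec.1
  isPullback := h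

end HomMk

section Push

variable [ChosenPullbacks C] [ChosenPushforwards C] (Δ : DistributivityPullback C) {Z' Y' : C}
  {P : Δ.Z ⟶ Z'} {ϖ : Δ.Y ⟶ Y'} {π' : Z' ⟶ Y'} (h : IsPullback Δ.π P ϖ π')

/-- The map `P_* D ⟶ ϖ_* F` over `π'` given by `κ`. -/
noncomputable abbrev pushκ : CartPair.mk (Δ.d ≫ Δ.e) P ⟶ CartPair.mk Δ.f ϖ :=
  ⟨Δ.κ, Δ.π, π', Δ.isPullback, h⟩

section

variable {W K : C} {w : W ⟶ Y'} {k₁ : K ⟶ W} {k₂ : K ⟶ Z'}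
  {WA KA : C} {w₁ : WA ⟶ W} {w₂ : WA ⟶ Δ.Y} (hWA : IsPullback w₁ w₂ w ϖ) {c₁ : KA ⟶ K}
  {c₂ : KA ⟶ Δ.Z} (hKA : IsPullback c₁ c₂ k₂ P) {k : KA ⟶ WA} (hk₁ : k ≫ w₁ = c₁ ≫ k₁)
  (hk₂ : k ≫ w₂ = c₂ ≫ Δ.π)

include hWA hKA hk₁ hk₂ in
lemma exists_lift_push (hw : k₁ ≫ w = k₂ ≫ π') {n : WA ⟶ Δ.F} (hn : n ≫ Δ.f = w₂) {m : KA ⟶ Δ.D}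
    (hκ : m ≫ Δ.κ = k ≫ n) {g : K ⟶ (push Δ.e P).left} (hg : g ≫ (push Δ.e P).hom = k₂)
    (hm : m ≫ Δ.d = pushApp Δ.e P (c₁ ≫ g) c₂ (by rw [Category.assoc, hg, hKA.w])) :
    ∃ n' : W ⟶ (push Δ.f ϖ).left, n' ≫ (push Δ.f ϖ).hom = w ∧
      ∃ m' : K ⟶ (push (Δ.d ≫ Δ.e) P).left,
        m' ≫ pushMap (Δ.pushκ h) = k₁ ≫ n' ∧ m' ≫ pushArrow Δ.d Δ.e P = g := by
  have hme : m ≫ Δ.d ≫ Δ.e = c₂ := by rw [reassoc_of% hm, pushApp_comp]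
  refine ⟨pushLift _ _ hWA n hn, pushLift_hom _ _ _ _ _, pushLift _ _ hKA m hme, ?_, ?_⟩
  · refine push_ext_of_hom (Δ.pushκ h) (w := k₂) ?_ ?_ fun t a ha hl hr => ?_
    · rw [Category.assoc, pushMap_hom, ← Category.assoc, pushLift_hom]
    · rw [Category.assoc, pushLift_hom, hw]
    · have ha' : (t ≫ k₁) ≫ w = (a ≫ Δ.π) ≫ ϖ := by
        rw [Category.assoc, hw, reassoc_of% ha, Category.assoc, h.w]
      simp only [← Category.assoc] at hl hr ⊢
      rw [pushApp_pushMap (Δ.pushκ h) _ a rfl _ (by rw [Category.assoc, pushLift_hom, ha]),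
        pushApp_pushLift _ _ _ _ _ _ _ _ ha, pushApp_pushLift _ _ _ _ _ _ _ _ ha',
        Category.assoc, hκ, ← Category.assoc]
      congr 1
      apply hWA.hom_ext
      · rw [Category.assoc, hk₁, ← Category.assoc, hKA.lift_fst, hWA.lift_fst]
      · rw [Category.assoc, hk₂, ← Category.assoc, hKA.lift_snd, hWA.lift_snd]
  · refine push_ext _ _ ?_ fun t a hl hr => ?_
    · rw [Category.assoc, pushArrow_hom, pushLift_hom, hg]
    · have ha : t ≫ k₂ = a ≫ P := by rw [← hr, Category.assoc, hg]
      simp only [← Category.assoc] at hl ⊢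
      rw [pushApp_pushArrow _ _ _ _ _ _ (by rw [Category.assoc, pushLift_hom, ha]),
        pushApp_pushLift _ _ _ _ _ _ _ _ ha, Category.assoc, hm, comp_pushApp]
      exact pushApp_congr _ _ (by rw [← Category.assoc, hKA.lift_fst]) (hKA.lift_snd _ _ _)

include hKA hk₁ hk₂ in
lemma exists_lift_of_push {n : W ⟶ (push Δ.f ϖ).left} (hn : n ≫ (push Δ.f ϖ).hom = w)
    {m : K ⟶ (push (Δ.d ≫ Δ.e) P).left} (hκ : m ≫ pushMap (Δ.pushκ h) = k₁ ≫ n)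
    {g : K ⟶ (push Δ.e P).left} (hg : g ≫ (push Δ.e P).hom = k₂)
    (hm : m ≫ pushArrow Δ.d Δ.e P = g) :
    ∃ m' : KA ⟶ Δ.D,
      m' ≫ Δ.κ = k ≫ pushApp Δ.f ϖ (w₁ ≫ n) w₂ (by rw [Category.assoc, hn, hWA.w]) ∧
      m' ≫ Δ.d = pushApp Δ.e P (c₁ ≫ g) c₂ (by rw [Category.assoc, hg, hKA.w]) := by
  have hm₂ : (c₁ ≫ m) ≫ (push (Δ.d ≫ Δ.e) P).hom = c₂ ≫ P := by
    rw [← pushArrow_hom, Category.assoc, reassoc_of% hm, hg, hKA.w]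
  have hc : (c₁ ≫ m) ≫ pushMap (Δ.pushκ h) = k ≫ w₁ ≫ n := by
    rw [Category.assoc, hκ, reassoc_of% hk₁]
  refine ⟨pushApp (Δ.d ≫ Δ.e) P (c₁ ≫ m) c₂ hm₂, ?_, ?_⟩
  · have hl : ((c₁ ≫ m) ≫ pushMap (Δ.pushκ h)) ≫ (push Δ.f ϖ).hom = (c₂ ≫ Δ.π) ≫ ϖ := by
      rw [hc, ← hk₂, Category.assoc, Category.assoc, hn, hWA.w, Category.assoc]
    rw [← pushApp_pushMap (Δ.pushκ h) (c₁ ≫ m) c₂ rfl hl, comp_pushApp]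
    exact pushApp_congr _ _ hc hk₂.symm
  · have hl : ((c₁ ≫ m) ≫ pushArrow Δ.d Δ.e P) ≫ (push Δ.e P).hom = c₂ ≫ P := by
      rw [Category.assoc c₁, hm, Category.assoc, hg, hKA.w]
    rw [← pushApp_pushArrow _ _ _ _ _ hl hm₂]
    exact pushApp_congr _ _ (by rw [Category.assoc, hm]) rfl

end

lemma existsUnique_lift_push {W K : C} {w : W ⟶ Y'} {k₁ : K ⟶ W} {k₂ : K ⟶ Z'}
    (hK : IsPullback k₁ k₂ w π') (g : K ⟶ (push Δ.e P).left) (hg : g ≫ (push Δ.e P).hom = k₂) :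
    ∃! n : W ⟶ (push Δ.f ϖ).left, n ≫ (push Δ.f ϖ).hom = w ∧
      ∃ m : K ⟶ (push (Δ.d ≫ Δ.e) P).left,
        m ≫ pushMap (Δ.pushκ h) = k₁ ≫ n ∧ m ≫ pushArrow Δ.d Δ.e P = g := by
  have hWA := ChosenPullbacksAlong.isPullback w ϖ
  have hKA := ChosenPullbacksAlong.isPullback k₂ P
  obtain ⟨k, hk₁, hk₂⟩ := hWA.exists_lift (_ ≫ k₁) (_ ≫ Δ.π)
    (by rw [Category.assoc, hK.w, reassoc_of% hKA.w, Category.assoc, h.w])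
  have lift_n := Δ.existsUnique_lift (isPullback_of_cube h.w hK hWA hKA hk₁ hk₂)
    (pushApp Δ.e P (_ ≫ g) _ (by rw [Category.assoc, hg, hKA.w])) (pushApp_comp _ _ _ _ _)
  apply existsUnique_of_exists_of_unique
  · obtain ⟨n, hn, m, hκ, hm⟩ := lift_n.exists
    exact Δ.exists_lift_push h hWA hKA hk₁ hk₂ hK.w hn hκ hg hm
  · rintro n n' ⟨hn, m, hκ, hm⟩ ⟨hn', m', hκ', hm'⟩
    have e := lift_n.unique
      ⟨pushApp_comp _ _ _ _ _, Δ.exists_lift_of_push h hWA hKA hk₁ hk₂ hn hκ hg hm⟩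
      ⟨pushApp_comp _ _ _ _ _, Δ.exists_lift_of_push h hWA hKA hk₁ hk₂ hn' hκ' hg hm'⟩
    exact push_hom_ext Δ.f ϖ (hn ▸ hWA) (hn'.trans hn.symm) e

/-- The pushforward of a distributivity pullback along a pullback square from `π` to `π'`. -/
noncomputable def push : DistributivityPullback C where
  d := pushArrow Δ.d Δ.e P
  e := (StructuredFrobenius.push Δ.e P).hom
  π := π'
  κ := pushMap (Δ.pushκ h)
  f := (StructuredFrobenius.push Δ.f ϖ).hom
  isPullback := by
    rw [pushArrow_hom]
    exact isPullback_pushMap (Δ.pushκ h)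
  existsUnique_lift := Δ.existsUnique_lift_push h

end Push

end DistributivityPullback

end DistributivityPullback

section Interval

open ChosenPullbacksAlong ExponentiableMorphism

variable {C : Type u} [Category.{v} C] [HasTerminal C] [ChosenPullbacks C] (I : C)

lemma isPullback_timesIFst {X Y : C} (f : X ⟶ Y) :
    IsPullback ((timesIFst I).app X) ((timesI I).map f) f ((timesIFst I).app Y) := by
  have h (Z : C) : IsPullback ((timesIFst I).app Z) ((bangPullback I).obj Z).hom
      (terminal.from Z) (terminal.from I) := isPullback (terminal.from Z) (terminal.from I)
  refine (IsPullback.of_right ?_ ((timesIFst I).naturality f) (h Y).flip).flip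
  have e₁ : (timesI I).map f ≫ ((bangPullback I).obj Y).hom = ((bangPullback I).obj X).hom :=
    Over.w ((bangPullback I).map f)
  have e₂ : f ≫ terminal.from Y = terminal.from X := terminal.hom_ext _ _
  exact e₁ ▸ e₂ ▸ (h X).flip

variable [ChosenPushforwards C]

lemma bangPullback_map_comp_evalOver {W X : C} (γ : W ⟶ (pathObj I).obj X) :
    (bangPullback I).map γ ≫ evalOver I X =
      ((pullbackPushforwardAdj (terminal.from I)).homEquiv (toSlice.obj W) _).symm
        (toSlice.map γ ≫ toSlicePathObj I X) := by
  rw [Adjunction.homEquiv_counit, Functor.map_comp]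
  exact (Category.assoc _ _ _).symm

lemma timesI_map_comp_evalI {W X : C} (γ : W ⟶ (pathObj I).obj X) :
    (timesI I).map γ ≫ (evalI I).app X =
      (((mapPullbackAdj (terminal.from I)).homEquiv ((bangPullback I).obj W) (toSlice.obj X)).symm
        ((bangPullback I).map γ ≫ evalOver I X)).left := by
  rw [Adjunction.homEquiv_counit]
  exact (Category.assoc _ _ _).symm

lemma existsUnique_path {W X : C} (g : (timesI I).obj W ⟶ X) :
    ∃! γ : W ⟶ (pathObj I).obj X, (timesI I).map γ ≫ (evalI I).app X = g := by
  let adj := (mapPullbackAdj (terminal.from I)).homEquiv ((bangPullback I).obj W) (toSlice.obj X)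
  let adj' := (pullbackPushforwardAdj (terminal.from I)).homEquiv (toSlice.obj W)
    ((bangPullback I).obj X)
  let e : (W ⟶ (pathObj I).obj X) ≃ (toSlice.obj W ⟶
      (pushforward (terminal.from I)).obj ((bangPullback I).obj X)) :=
    { toFun γ := toSlice.map γ ≫ toSlicePathObj I X
      invFun φ := φ.left
      left_inv γ := Category.comp_id γ
      right_inv φ := Over.OverMorphism.ext (Category.comp_id _) }
  let e' : ((Over.map (terminal.from I)).obj ((bangPullback I).obj W) ⟶ toSlice.obj X) ≃
      ((timesI I).obj W ⟶ X) :=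
    { toFun φ := φ.left
      invFun g := Over.homMk g (terminal.hom_ext _ _)
      left_inv _ := rfl
      right_inv _ := rfl }
  have key : (fun γ : W ⟶ (pathObj I).obj X => (timesI I).map γ ≫ (evalI I).app X) =
      ((e.trans adj'.symm).trans adj.symm).trans e' := by
    funext γ
    refine (timesI_map_comp_evalI I γ).trans ?_
    exact congrArg (fun φ => (adj.symm φ).left) (bangPullback_map_comp_evalOver I γ)
  exact Function.Bijective.existsUnique (key ▸ Equiv.bijective _) g

section

variable {R Y : C} (r : R ⟶ Y)

lemma leibniz_fst : leibniz I r ≫ fst _ _ = (evalI I).app R := lift_fst _ _ _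

lemma leibniz_snd : leibniz I r ≫ snd _ _ = (pathTimes I).map r := lift_snd _ _ _

lemma existsUnique_path_lift {W : C} (w : W ⟶ (pathObj I).obj Y)
    (g : (timesI I).obj W ⟶ pullbackObj r ((evalI I).app Y))
    (hg : g ≫ snd _ _ = (timesI I).map w) :
    ∃! n : W ⟶ (pathObj I).obj R,
      n ≫ (pathObj I).map r = w ∧ (timesI I).map n ≫ leibniz I r = g := by
  obtain ⟨n, hn, unique⟩ := existsUnique_path I (g ≫ fst _ _)
  have hnr : n ≫ (pathObj I).map r = w := by
    apply (existsUnique_path I ((timesI I).map w ≫ (evalI I).app Y)).unique _ rfl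
    calc (timesI I).map (n ≫ (pathObj I).map r) ≫ (evalI I).app Y
      _ = (timesI I).map n ≫ (evalI I).app R ≫ r := by
        rw [Functor.map_comp, Category.assoc]
        exact congrArg _ ((evalI I).naturality r)
      _ = (g ≫ fst _ _) ≫ r := by rw [← Category.assoc, hn]
      _ = g ≫ snd _ _ ≫ (evalI I).app Y := by rw [Category.assoc, condition]
      _ = (timesI I).map w ≫ (evalI I).app Y := by rw [← Category.assoc, hg]
  refine ⟨n, ⟨hnr, ?_⟩, fun n' h => unique n' ?_⟩
  · apply ChosenPullbacksAlong.hom_ext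
    · rw [Category.assoc, leibniz_fst, hn]
    · rw [Category.assoc, leibniz_snd, hg, ← hnr, Functor.map_comp]
      rfl
  · rw [← h.2, Category.assoc, leibniz_fst]

lemma existsUnique_lift_leibniz {W K : C} {w : W ⟶ (pathObj I).obj Y} {k₁ : K ⟶ W}
    {k₂ : K ⟶ (pathTimes I).obj Y} (hK : IsPullback k₁ k₂ w ((timesIFst I).app _))
    (g : K ⟶ pullbackObj r ((evalI I).app Y)) (hg : g ≫ snd _ _ = k₂) :
    ∃! n : W ⟶ (pathObj I).obj R, n ≫ (pathObj I).map r = w ∧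
      ∃ m : K ⟶ (pathTimes I).obj R, m ≫ (timesIFst I).app _ = k₁ ≫ n ∧ m ≫ leibniz I r = g := by
  let j := hK.isoIsPullback _ _ (isPullback_timesIFst I w)
  have hj₁ : j.hom ≫ (timesIFst I).app W = k₁ := hK.isoIsPullback_hom_fst _ _ _
  have hj₂ : j.hom ≫ (timesI I).map w = k₂ := hK.isoIsPullback_hom_snd _ _ _
  have hj : (j.inv ≫ g) ≫ snd _ _ = (timesI I).map w := by
    rw [Category.assoc, hg, ← hj₂, Iso.inv_hom_id_assoc]
  have natural (n : W ⟶ (pathObj I).obj R) :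
      (j.hom ≫ (timesI I).map n) ≫ (timesIFst I).app _ = k₁ ≫ n := by
    rw [Category.assoc, (timesIFst I).naturality, reassoc_of% hj₁]
    rfl
  obtain ⟨n, ⟨hnw, hng⟩, unique⟩ := existsUnique_path_lift I r w (j.inv ≫ g) hj
  refine ⟨n, ⟨hnw, j.hom ≫ (timesI I).map n, natural n, ?_⟩, ?_⟩
  · rw [Category.assoc, hng, Iso.hom_inv_id_assoc]
  rintro n' ⟨hn', m, hκ, hm⟩
  have hm' : m = j.hom ≫ (timesI I).map n' := by
    apply (isPullback_timesIFst I ((pathObj I).map r)).hom_ext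
    · rw [hκ, natural]
    · rw [Category.assoc, ← Functor.map_comp, hn', hj₂, ← hg, ← hm, Category.assoc, leibniz_snd]
      rfl
  exact unique n' ⟨hn', by rw [← hm, hm', Category.assoc, Iso.inv_hom_id_assoc]⟩

/-- The distributivity pullback around `r_ε` and the projection `Y^I × I ⟶ Y^I`: the counit of
`δ ⇒ r`. -/
noncomputable def leibnizPullback : DistributivityPullback C where
  d := leibniz I r
  e := snd r ((evalI I).app Y)
  π := (timesIFst I).app ((pathObj I).obj Y)
  κ := (timesIFst I).app ((pathObj I).obj R)
  f := (pathObj I).map r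
  isPullback := by
    rw [leibniz_snd]
    exact isPullback_timesIFst I ((pathObj I).map r)
  existsUnique_lift := existsUnique_lift_leibniz I r

end

/-- The action of a pullback square on `leibnizPullback`. -/
noncomputable def leibnizPullbackMap {A X A' X' : C} {p' : A' ⟶ X'} {p : A ⟶ X} {a : A' ⟶ A}
    {x : X' ⟶ X} (h : IsPullback a p' p x) : leibnizPullback I p' ⟶ leibnizPullback I p where
  d := (pathTimes I).map a
  e := leibnizBase I h.w
  z := (pathTimes I).map x
  f := (pathObj I).map a
  y := (pathObj I).map x
  w_d := (isPullback_leibniz I h).w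
  w_e := leibnizBase_snd I h.w
  w_κ := (timesIFst I).naturality _
  w_f := (h.map (pathObj I)).w
  isPullback := (isPullback_timesIFst I ((pathObj I).map x)).flip

/-- The functor that takes `(q, p)` to the triple that consists of `δ ⇒ q`, the projection of its
codomain, and `p^I × I`. -/
noncomputable def leibnizTriple : CartPair C ⥤ CartTriple C where
  obj S := ⟨leibniz I S.q, snd S.q ((evalI I).app S.A), (pathTimes I).map S.p⟩
  map f :=
    { d := (pathTimes I).map f.b
      b := leibnizBase I f.isPullback_q.w
      a := (pathTimes I).map f.a
      x := (pathTimes I).map f.x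
      isPullback_r := isPullback_leibniz I f.isPullback_q
      isPullback_q := isPullback_leibnizBase I f.isPullback_q
      isPullback_p := f.isPullback_p.map (pathTimes I) }
  map_id S := by
    apply CartTriple.Hom.ext
    · exact (pathTimes I).map_id _
    · exact leibnizBase_id I S.q (by simp)
    · exact (pathTimes I).map_id _
    · exact (pathTimes I).map_id _
  map_comp f g := by
    apply CartTriple.Hom.ext
    · exact (pathTimes I).map_comp _ _
    · exact leibnizBase_comp I f.isPullback_q.w g.isPullback_q.w (f ≫ g).isPullback_q.w
    · exact (pathTimes I).map_comp _ _
    · exact (pathTimes I).map_comp _ _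

/-- The pushforward of the distributivity pullback of `δ ⇒ q` along `p^I × I`. -/
noncomputable def pushLeibnizPullback (S : CartPair C) : DistributivityPullback C :=
  (leibnizPullback I S.q).push (isPullback_timesIFst I ((pathObj I).map S.p))

variable {I} in
lemma pushLeibnizPullback_w_κ {S T : CartPair C} (f : S ⟶ T) :
    pushMap ((leibnizTriple I).map f).compPair ≫ (pushLeibnizPullback I T).κ =
      (pushLeibnizPullback I S).κ ≫
        pushMap (S := ⟨(pathObj I).map S.q, (pathObj I).map S.p⟩)
          (T := ⟨(pathObj I).map T.q, (pathObj I).map T.p⟩)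
          ⟨(pathObj I).map f.b, (pathObj I).map f.a, (pathObj I).map f.x,
            f.isPullback_q.map (pathObj I), f.isPullback_p.map (pathObj I)⟩ := by
  refine (pushMap_comp _ _).symm.trans ((congrArg pushMap ?_).trans (pushMap_comp _ _))
  apply CartPair.Hom.ext
  all_goals exact (timesIFst I).naturality _

/-- The action of a cartesian morphism of pairs on `pushLeibnizPullback`. -/
noncomputable def pushLeibnizPullbackMap {S T : CartPair C} (f : S ⟶ T) :
    pushLeibnizPullback I S ⟶ pushLeibnizPullback I T where
  d := pushMap ((leibnizTriple I).map f).compPair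
  e := pushMap ((leibnizTriple I).map f).pair
  z := (pathTimes I).map f.x
  f := pushMap _
  y := (pathObj I).map f.x
  w_d := pushArrow_naturality _ _ ((leibnizTriple I).map f).isPullback_r.w rfl rfl
  w_e := pushMap_hom _
  w_κ := pushLeibnizPullback_w_κ f
  w_f := pushMap_hom _
  isPullback := (isPullback_timesIFst I ((pathObj I).map f.x)).flip

/-- The Beck–Chevalley square whose gap map is `δ ⇒ p`. -/
noncomputable def leibnizSquare (S : CartPair C) :
    BeckChevalleySquare ⟨snd S.q ((evalI I).app S.A), (pathTimes I).map S.p⟩ S where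
  b := fst _ _
  a := (evalI I).app S.A
  x := (evalI I).app S.X
  w := ((evalI I).naturality S.p).symm
  isPullback_q := isPullback _ _

end Interval

section LeibnizRetract

open ChosenPullbacksAlong DistributivityPullback

variable {C : Type u} [Category.{v} C] [HasTerminal C] [ChosenPullbacks C] [ChosenPushforwards C]
  {I : C}

/-- `δ ⇒ p_* q` as a retract of the pushforward of `δ ⇒ q` along `p^I × I`, given a section of
`δ ⇒ p`. -/
noncomputable def leibnizRetract (S : CartPair C)
    {σ : pullbackObj S.p ((evalI I).app S.X) ⟶ (pathTimes I).obj S.A}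
    (hσ : σ ≫ leibniz I S.p = 𝟙 _) :
    Retract (leibnizPullback I (push S.q S.p).hom) (pushLeibnizPullback I S) where
  i := homMk (leibnizSquare I S).comparison (𝟙 _) (𝟙 _)
    ((leibnizSquare I S).comparison_hom.trans (Category.comp_id _).symm) .of_id_fst
  r := homMk ((leibnizSquare I S).retraction hσ) (𝟙 _) (𝟙 _)
    (((leibnizSquare I S).retraction_snd hσ).trans (Category.comp_id _).symm) .of_id_fst
  retract := Hom.ext ((leibnizSquare I S).comparison_retraction hσ) (Category.comp_id _)
    (Category.comp_id _)

section

variable {S T : CartPair C} (f : S ⟶ T)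
  {σ : pullbackObj S.p ((evalI I).app S.X) ⟶ (pathTimes I).obj S.A}
  {τ : pullbackObj T.p ((evalI I).app T.X) ⟶ (pathTimes I).obj T.A}
  (hσ : σ ≫ leibniz I S.p = 𝟙 _) (hτ : τ ≫ leibniz I T.p = 𝟙 _)

lemma leibnizRetract_i_naturality :
    (leibnizRetract S hσ).i ≫ pushLeibnizPullbackMap I f =
      leibnizPullbackMap I (isPullback_pushMap f) ≫ (leibnizRetract T hτ).i :=
  Hom.ext
    (BeckChevalleySquare.comparison_naturality (Q := leibnizSquare I S) (R := leibnizSquare I T)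
      (leibnizBase_fst I f.isPullback_q.w) ((evalI I).naturality f.a)
      ((evalI I).naturality f.x)).symm
    ((Category.id_comp _).trans (Category.comp_id _).symm)
    ((Category.id_comp _).trans (Category.comp_id _).symm)

lemma leibnizRetract_r_naturality
    (hn : σ ≫ (pathTimes I).map f.a = leibnizBase I f.isPullback_p.w ≫ τ) :
    (leibnizRetract S hσ).r ≫ leibnizPullbackMap I (isPullback_pushMap f) =
      pushLeibnizPullbackMap I f ≫ (leibnizRetract T hτ).r :=
  Hom.ext
    (BeckChevalleySquare.retraction_naturality (Q := leibnizSquare I S) (R := leibnizSquare I T)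
      (f := f) (f' := ((leibnizTriple I).map f).pair) (leibnizBase_fst I f.isPullback_q.w)
      ((evalI I).naturality f.x) hσ hτ hn).symm
    ((Category.id_comp _).trans (Category.comp_id _).symm)
    ((Category.id_comp _).trans (Category.comp_id _).symm)

end

variable {D : Type u₁} [Category.{v₁} D]

/-- The functoriality of `leibnizRetract`. -/
noncomputable def leibnizRetractFunctor (K : D ⥤ CartPair C)
    (σ : ∀ d, pullbackObj (K.obj d).p ((evalI I).app (K.obj d).X) ⟶
      (pathTimes I).obj (K.obj d).A)
    (hσ : ∀ d, σ d ≫ leibniz I (K.obj d).p = 𝟙 _)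
    (hn : ∀ {d d' : D} (f : d ⟶ d'), σ d ≫ (pathTimes I).map (K.map f).a =
      leibnizBase I (K.map f).isPullback_p.w ≫ σ d') : D ⥤ CartRetract C where
  obj d := ⟨⟨(leibnizRetract (K.obj d) (hσ d)).map (counit C)⟩⟩
  map {d d'} f :=
    { hom :=
        { retr := ((pushPair ⋙ leibnizFunctor I).map (K.map f)).hom
          center := ((leibnizTriple I ⋙ pushTriple ⋙ CartPair.ev01 C).map (K.map f)).hom
          w_i := congrArg (counit C).map
            (leibnizRetract_i_naturality (K.map f) (hσ d) (hσ d'))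
          w_r := congrArg (counit C).map
            (leibnizRetract_r_naturality (K.map f) (hσ d) (hσ d') (hn f)) }
      property := ⟨((leibnizTriple I ⋙ pushTriple ⋙ CartPair.ev01 C).map (K.map f)).property,
        ((pushPair ⋙ leibnizFunctor I).map (K.map f)).property⟩ }
  map_id d := by
    apply WideSubcategory.hom_ext
    apply RetractDiagram.Hom.ext
    · exact congrArg (fun φ => φ.hom) ((K ⋙ pushPair ⋙ leibnizFunctor I).map_id d)
    · exact congrArg (fun φ => φ.hom)
        ((K ⋙ leibnizTriple I ⋙ pushTriple ⋙ CartPair.ev01 C).map_id d)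
  map_comp f g := by
    apply WideSubcategory.hom_ext
    apply RetractDiagram.Hom.ext
    · exact congrArg (fun φ => φ.hom) ((K ⋙ pushPair ⋙ leibnizFunctor I).map_comp f g)
    · exact congrArg (fun φ => φ.hom)
        ((K ⋙ leibnizTriple I ⋙ pushTriple ⋙ CartPair.ev01 C).map_comp f g)

end LeibnizRetract

section Frobenius

open ChosenPullbacksAlong

variable {C : Type u} [Category.{v} C]

lemma exists_natural_section {D : Type u₁} [Category.{v₁} D] {G : D ⥤ CartArrow C}
    (s : D ⥤ CartSection C) (h : s ⋙ CartSection.arrow C = G) :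
    ∃ σ : ∀ d, (G.obj d).obj.right ⟶ (G.obj d).obj.left,
      (∀ d, σ d ≫ (G.obj d).obj.hom = 𝟙 _) ∧
      ∀ {d d' : D} (f : d ⟶ d'), σ d ≫ (G.map f).hom.left = (G.map f).hom.right ≫ σ d' := by
  subst h
  exact ⟨fun d => (s.obj d).obj.ret.i, fun d => (s.obj d).obj.ret.retract,
    fun f => (s.map f).hom.w_i⟩

variable {TFib : Type u₁} [Category.{v₁} TFib] {U : TFib ⥤ Arrow C}
  (hU : IsFibredNotionOfStructure U) [HasTerminal C] [ChosenPullbacks C] [ChosenPushforwards C]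
  (I : C)

lemma isDiscreteFibration_uFib : IsDiscreteFibration (uFib hU I) :=
  StrictPullback.isDiscreteFibration_π₁ _ hU.isDiscreteFibration

lemma isDiscreteFibration_uFibPair : IsDiscreteFibration (uFibPair hU I) :=
  StrictPullback.isDiscreteFibration_π₂ _
    ((isDiscreteFibration_uFib hU I).prod (isDiscreteFibration_uFib hU I))

/-- The trivial fibration structure of `δ ⇒ p`, for a structured fibration `p`. -/
noncomputable def FibCart.tfib : FibCart hU I ⥤ Cart (U ⋙ Arrow.rightFunc) :=
  StrictPullback.π₂ _ _

lemma FibCart.tfib_comp_uCart : FibCart.tfib hU I ⋙ uCart hU = uFib hU I ⋙ leibnizFunctor I :=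
  (StrictPullback.π₁_comp _ _).symm

/-- `(q, p) ↦ q` on structured fibrations. -/
noncomputable def FibPair.ev01 : FibPair hU I ⥤ FibCart hU I :=
  StrictPullback.π₁ _ _ ⋙ CategoryTheory.Prod.fst _ _

/-- `(q, p) ↦ p` on structured fibrations. -/
noncomputable def FibPair.ev12 : FibPair hU I ⥤ FibCart hU I :=
  StrictPullback.π₁ _ _ ⋙ CategoryTheory.Prod.snd _ _

lemma FibPair.ev01_comp_uFib : FibPair.ev01 hU I ⋙ uFib hU I = uFibPair hU I ⋙ CartPair.ev01 C :=
  congrArg (· ⋙ CategoryTheory.Prod.fst _ _) (StrictPullback.π₁_comp _ _)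

lemma FibPair.ev12_comp_uFib : FibPair.ev12 hU I ⋙ uFib hU I = uFibPair hU I ⋙ CartPair.ev12 C :=
  congrArg (· ⋙ CategoryTheory.Prod.snd _ _) (StrictPullback.π₁_comp _ _)

lemma FibPair.ev01_tfib_comp_uCart : (FibPair.ev01 hU I ⋙ FibCart.tfib hU I) ⋙ uCart hU =
    (uFibPair hU I ⋙ leibnizTriple I) ⋙ CartTriple.ev01 C := by
  rw [Functor.assoc, FibCart.tfib_comp_uCart, ← Functor.assoc, FibPair.ev01_comp_uFib]
  rfl

lemma FibPair.ev12_tfib_comp_uCart : (FibPair.ev12 hU I ⋙ FibCart.tfib hU I) ⋙ uCart hU =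
    uFibPair hU I ⋙ CartPair.ev12 C ⋙ leibnizFunctor I := by
  rw [Functor.assoc, FibCart.tfib_comp_uCart, ← Functor.assoc, FibPair.ev12_comp_uFib]
  rfl

variable {hU}

lemma HasStableSections.exists_leibniz_section (tf1 : HasStableSections hU) :
    ∃ σ : ∀ z : FibPair hU I,
        pullbackObj ((uFibPair hU I).obj z).p ((evalI I).app ((uFibPair hU I).obj z).X) ⟶
          (pathTimes I).obj ((uFibPair hU I).obj z).A,
      (∀ z, σ z ≫ leibniz I ((uFibPair hU I).obj z).p = 𝟙 _) ∧
      ∀ {z z' : FibPair hU I} (f : z ⟶ z'),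
        σ z ≫ (pathTimes I).map ((uFibPair hU I).map f).a =
          leibnizBase I ((uFibPair hU I).map f).isPullback_p.w ≫ σ z' := by
  obtain ⟨s, hs⟩ := tf1
  exact exists_natural_section ((FibPair.ev12 hU I ⋙ FibCart.tfib hU I) ⋙ s)
    ((congrArg (FibPair.ev12 hU I ⋙ FibCart.tfib hU I ⋙ ·) hs).trans
      (FibPair.ev12_tfib_comp_uCart hU I))

lemma HasPushforwardLift.exists_tfib_push_leibniz (tf2 : HasPushforwardLift hU) :
    ∃ N : FibPair hU I ⥤ Cart (U ⋙ Arrow.rightFunc),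
      N ⋙ uCart hU = uFibPair hU I ⋙ leibnizTriple I ⋙ pushTriple ⋙ CartPair.ev01 C := by
  obtain ⟨L, hL⟩ := tf2
  let T := StrictPullback.lift (F := uCart hU) (G := CartTriple.ev01 C) _ _
    (FibPair.ev01_tfib_comp_uCart hU I)
  exact ⟨T ⋙ L ⋙ StrictPullback.π₁ _ _,
    (congrArg (T ⋙ L ⋙ ·) (StrictPullback.π₁_comp (uCart hU) (CartPair.ev01 C))).trans
      (congrArg (T ⋙ · ⋙ CartPair.ev01 C) hL)⟩

lemma exists_pushforward_fib (tf1 : HasStableSections hU) (tf2 : HasPushforwardLift hU)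
    (tf3 : HasRetractLift hU) :
    ∃ P : FibPair hU I ⥤ FibCart hU I, P ⋙ uFib hU I = uFibPair hU I ⋙ pushPair := by
  obtain ⟨σ, hσ, hn⟩ := tf1.exists_leibniz_section I
  obtain ⟨N, hN⟩ := tf2.exists_tfib_push_leibniz I
  obtain ⟨M, hM⟩ := tf3
  let R := StrictPullback.lift (F := CartRetract.evCenter C) (G := uCart hU)
    (leibnizRetractFunctor (uFibPair hU I) σ hσ hn) N hN.symm
  exact ⟨StrictPullback.lift (uFibPair hU I ⋙ pushPair) (R ⋙ M) (congrArg (R ⋙ ·) hM).symm, rfl⟩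

end Frobenius

end StructuredFrobenius

theorem mainTheorem4 {C : Type*} [Category* C] [HasTerminal C] [ChosenPullbacks C]
    [ChosenPushforwards C] (I : C) {TFib : Type*} [Category* TFib] (U : TFib ⥤ Arrow C)
    (tf0 : IsFibredNotionOfStructure U)
    (tf1 : HasStableSections tf0)
    (tf2 : HasPushforwardLift tf0)
    (tf3 : HasRetractLift tf0) :
    IsDiscreteFibration (uFib tf0 I) ∧
    (uFib tf0 I ⋙ CartArrow.cod C).IsFibered ∧
    (uFibPair tf0 I ⋙ CartPair.cod C).IsFibered ∧
    ∃ P : FibPair tf0 I ⥤ FibCart tf0 I,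
      P ⋙ uFib tf0 I = uFibPair tf0 I ⋙ pushPair ∧
      IsCartesianFunctor (uFibPair tf0 I ⋙ CartPair.cod C) (uFib tf0 I ⋙ CartArrow.cod C) P := by
  have h := isDiscreteFibration_uFib tf0 I
  have h' := isDiscreteFibration_uFibPair tf0 I
  have hcod := h.isFibredInGroupoids.comp (CartArrow.isFibredInGroupoids_cod C)
  have hcod' := h'.isFibredInGroupoids.comp (CartPair.isFibredInGroupoids_cod C)
  obtain ⟨P, hP⟩ := exists_pushforward_fib I tf1 tf2 tf3
  exact ⟨h, hcod.isFibered, hcod'.isFibered, P, hP, congrArg (· ⋙ CartArrow.cod C) hP,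
    fun φ _ => hcod.cartesianArrows (P.map φ)⟩
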